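/- Let $\Theta$ be the open unit disc of $\mathbb R^2$, let $J_0$ be the Bessel function of order zero with positive zeros $0<z_1<z_2<\cdots$, and let $e_n(x)=J_0(z_n|x|)/\|J_0(z_n|\cdot|)\|_{L^2(\Theta)}$, $n\ge1$, be the $L^2$-normalised radial Dirichlet eigenfunctions of $-\Delta$ on $\Theta$. For $s\ge 0$ put $e_{n,s}=z_n^{-s}e_n$ and let $H^s_{rad}(\Theta)$ be the space of all $u=\sum_{n\ge1} c_n e_{n,s}$ in $L^2(\Theta)$ with $\|u\|_{H^s_{rad}(\Theta)}^2=\sum_n|c_n|^2<\infty$, equipped with its Borel $\sigma$-algebra. Let $S_N$ be the projection $S_N u=\sum_{n\le N}\langle u,e_n\rangle e_n$. Let $V:\mathbb C\to\mathbb R$ be a $C^\infty$ function such that - $V(z)=G(|z|^2)$ for some smooth $G:\mathbb R\to\mathbb R$; - for some $\alpha\in(0,4)$ and for all integers $k_1,k_2\ge0$ there is $C>0$ with $|\partial^{k_1}\bar\partial^{k_2}V(z)|\le C(1+|z|)^{2+\alpha-k_1-k_2}$ for all $z\in\mathbb C$; - for some $\beta\in[2,4)$ and some $C>0$ one has $V(z)\ge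 -C(1+|z|)^\beta$ for all $z\in\mathbb C$. Let $\max\big(\tfrac13,\,1-\tfrac2\alpha,\,1-\tfrac2\beta\big)<s<\tfrac12$, and let $\mu$ be the Gaussian free measure on $H^s_{rad}(\Theta)$, that is, the law of the random series $\varphi=\sum_{n\ge1}\frac{g_n}{z_n}e_n$, where $(g_n)$ is an i.i.d. sequence of complex Gaussian variables $g_n=(h_n+il_n)/\sqrt2$ with $h_n,l_n$ independent standard real Gaussian variables. Then the map $u\mapsto\int_\Theta V(u)$ belongs to $L^1(d\mu)$; in particular $\int_\Theta V(u)$ is finite for $\mu$-almost every $u$. Moreover, for every $N$ the integral $\int_\Theta V(S_Nu)$ is finite for every $u\in H^s_{rad}(\Theta)$ and belongs to $L^1(d\mu)$ as a function of $u$, and $$\int_\Theta V(S_Nu)\longrightarrow\int_\Theta V(u)\quad\text{in }L^1(d\mu)\text{ as }N\to\infty .$$ Consequently, for every continuous, compactly supported $\chi:\mathbb R\to[0,\infty)$ that does not vanish identically on $[0,\infty)$, the Gibbs measure $$d\rho(u)=\chi\big(\|u\|_{L^2(\Theta)}\big)\exp\Big(-\int_\Theta V(u)\Big)d\mu(u)$$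 on $H^s_{rad}(\Theta)$ is nontrivial, i.e. $\rho\ne0$. -/

import Mathlib

open MeasureTheory ProbabilityTheory Filter Topology
open scoped ContDiff ENNReal

noncomputable section

namespace DiscNLS

/-! ### Assumptions on the potential -/

/-- The Wirtinger derivative `∂f = (∂ₓf - i ∂ᵧf) / 2`. -/
def dz (f : ℂ → ℂ) (z : ℂ) : ℂ :=
  (1 / 2 : ℂ) * (fderiv ℝ f z 1 - Complex.I * fderiv ℝ f z Complex.I)

/-- The conjugate Wirtinger derivative `∂̄f = (∂ₓf + i ∂ᵧf) / 2`. -/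
def dzbar (f : ℂ → ℂ) (z : ℂ) : ℂ :=
  (1 / 2 : ℂ) * (fderiv ℝ f z 1 + Complex.I * fderiv ℝ f z Complex.I)

/-- `V` is gauge invariant: `V(z) = G(|z|²)` with `G` smooth. -/
def GaugeInvariant (V : ℂ → ℝ) : Prop :=
  ∃ G : ℝ → ℝ, ContDiff ℝ ∞ G ∧ ∀ z : ℂ, V z = G (‖z‖ ^ 2)

/-- The growth assumption: for all `k₁, k₂` there is `C > 0` with
`|∂^{k₁} ∂̄^{k₂} V(z)| ≤ C (1 + |z|)^{2 + α - k₁ - k₂}` for all `z`. -/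
def GrowthBound (V : ℂ → ℝ) (α : ℝ) : Prop :=
  ∀ k₁ k₂ : ℕ, ∃ C : ℝ, 0 < C ∧ ∀ z : ℂ,
    ‖(dz^[k₁] (dzbar^[k₂] (fun w => (V w : ℂ)))) z‖ ≤
      C * (1 + ‖z‖) ^ (2 + α - (k₁ : ℝ) - (k₂ : ℝ))

/-- The defocusing assumption: `V(z) ≥ -C (1 + |z|)^β` for some `C > 0`. -/
def Defocusing (V : ℂ → ℝ) (β : ℝ) : Prop :=
  ∃ C : ℝ, 0 < C ∧ ∀ z : ℂ, -C * (1 + ‖z‖) ^ β ≤ V z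

/-! ### The Bessel function `J₀`, its zeros, and the radial Dirichlet eigenfunctions -/

/-- The Bessel function of order zero, `J₀(x) = π⁻¹ ∫₀^π cos(x sin θ) dθ`. -/
def besselJ0 (x : ℝ) : ℝ :=
  Real.pi⁻¹ * ∫ θ in (0 : ℝ)..Real.pi, Real.cos (x * Real.sin θ)

/-- The positive zeros of `J₀` in increasing order; `besselZero n` is `z_{n+1}`. -/
def besselZero : ℕ → ℝ
  | 0 => sInf {x : ℝ | 0 < x ∧ besselJ0 x = 0}
  | n + 1 => sInf {x : ℝ | besselZero n < x ∧ besselJ0 x = 0}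

/-- The open unit disc `Θ` of the plane. -/
def disc : Set (EuclideanSpace ℝ (Fin 2)) := Metric.ball 0 1

/-- Lebesgue measure on the unit disc. -/
def discMeasure : Measure (EuclideanSpace ℝ (Fin 2)) := volume.restrict disc

instance : IsFiniteMeasure discMeasure :=
  ⟨by simp [discMeasure, disc]⟩

/-- The complex Hilbert space `L²(Θ)`. -/
abbrev L2Disc : Type := Lp ℂ 2 discMeasure

/-- The eigenfunction `e_{n+1}(x) = J₀(z_{n+1} |x|) / ‖J₀(z_{n+1} |·|)‖_{L²(Θ)}`. -/
def eigenFun (n : ℕ) (x : EuclideanSpace ℝ (Fin 2)) : ℂ :=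
  ((besselJ0 (besselZero n * ‖x‖) /
    Real.sqrt (∫ y, besselJ0 (besselZero n * ‖y‖) ^ 2 ∂discMeasure) : ℝ) : ℂ)

theorem continuous_besselJ0 : Continuous besselJ0 := by
  unfold besselJ0
  refine continuous_const.mul ?_
  exact intervalIntegral.continuous_parametric_intervalIntegral_of_continuous'
    (by fun_prop) _ _

theorem abs_besselJ0_le_one (x : ℝ) : |besselJ0 x| ≤ 1 := by
  have h := intervalIntegral.norm_integral_le_of_norm_le_const
    (a := 0) (b := Real.pi) (C := 1) (f := fun θ => Real.cos (x * Real.sin θ))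
    (fun θ _ => by simpa using Real.abs_cos_le_one _)
  rw [sub_zero, one_mul, abs_of_pos Real.pi_pos, Real.norm_eq_abs] at h
  unfold besselJ0
  rw [abs_mul, abs_of_pos (inv_pos.2 Real.pi_pos)]
  calc _ ≤ Real.pi⁻¹ * Real.pi := by gcongr
    _ = 1 := inv_mul_cancel₀ Real.pi_ne_zero

theorem memLp_eigenFun (n : ℕ) : MemLp (eigenFun n) 2 discMeasure := by
  refine MemLp.of_bound (C := 1 /
    Real.sqrt (∫ y, besselJ0 (besselZero n * ‖y‖) ^ 2 ∂discMeasure)) ?_ ?_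
  · refine Continuous.aestronglyMeasurable ?_
    unfold eigenFun
    have := continuous_besselJ0
    fun_prop
  · refine Eventually.of_forall fun x => ?_
    unfold eigenFun
    rw [Complex.norm_real, Real.norm_eq_abs, abs_div, abs_of_nonneg (Real.sqrt_nonneg _)]
    gcongr
    exact abs_besselJ0_le_one _

/-- The eigenfunction `e_{n+1}` as an element of `L²(Θ)`. -/
def eigen (n : ℕ) : L2Disc := (memLp_eigenFun n).toLp (eigenFun n)

/-! ### The Sobolev spaces `H^s_rad(Θ)` -/

/-- The coordinates `c_n = z_n^s ⟨u, e_n⟩` of `u` with respect to `e_{n,s} = z_n^{-s} e_n`. -/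
def coord (s : ℝ) (u : L2Disc) (n : ℕ) : ℂ :=
  ((besselZero n ^ s : ℝ) : ℂ) * inner ℂ (eigen n) u

theorem coord_add (s : ℝ) (u v : L2Disc) : coord s (u + v) = coord s u + coord s v := by
  funext n
  simp [coord, inner_add_right, mul_add]

theorem coord_smul (s : ℝ) (a : ℂ) (u : L2Disc) : coord s (a • u) = a • coord s u := by
  funext n
  simp only [coord, inner_smul_right, Pi.smul_apply, smul_eq_mul]
  ring

/-- The functions `u = ∑ c_n e_{n,s}` in `L²(Θ)` with `∑ |c_n|² < ∞`. -/
def hsSubmodule (s : ℝ) : Submodule ℂ L2Disc where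
  carrier := {u | HasSum (fun n => (inner ℂ (eigen n) u : ℂ) • eigen n) u ∧
    Memℓp (coord s u) 2}
  zero_mem' := by
    refine ⟨by simp, ?_⟩
    have : coord s 0 = 0 := by
      funext n
      simp [coord]
    rw [this]
    exact zero_memℓp
  add_mem' := by
    rintro u v ⟨hu, hu'⟩ ⟨hv, hv'⟩
    refine ⟨by simpa [inner_add_right, add_smul] using hu.add hv, ?_⟩
    rw [coord_add]
    exact hu'.add hv'
  smul_mem' := by
    rintro a u ⟨hu, hu'⟩
    refine ⟨by simpa [inner_smul_right, mul_smul] using hu.const_smul a, ?_⟩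
    rw [coord_smul]
    exact hu'.const_smul a

/-- The Sobolev space `H^s_rad(Θ)`. It is a type of its own, since it carries the `H^s` norm
and not the norm of `L²(Θ)`. -/
def HsRad (s : ℝ) : Type := hsSubmodule s

instance (s : ℝ) : AddCommGroup (HsRad s) := inferInstanceAs (AddCommGroup (hsSubmodule s))

instance (s : ℝ) : Module ℂ (HsRad s) := inferInstanceAs (Module ℂ (hsSubmodule s))

/-- An element of `H^s_rad(Θ)` as an element of `L²(Θ)`. -/
def HsRad.toL2 {s : ℝ} (u : HsRad s) : L2Disc := Subtype.val (p := (· ∈ hsSubmodule s)) u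

/-- The coordinate map `H^s_rad(Θ) → ℓ²`, `∑ c_n e_{n,s} ↦ (c_n)`. -/
def HsRad.toEll2 (s : ℝ) : HsRad s →ₗ[ℂ] lp (fun _ : ℕ => ℂ) 2 where
  toFun u := ⟨coord s u.toL2, u.2.2⟩
  map_add' u v := Subtype.ext (coord_add s u.toL2 v.toL2)
  map_smul' a u := Subtype.ext (coord_smul s a u.toL2)

/-- The `H^s` norm, `‖∑ c_n e_{n,s}‖² = ∑ |c_n|²`. As all `z_n` are positive, it vanishes only
for `u = 0`; declaring it through the seminorm class only saves a proof of this here. -/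
instance (s : ℝ) : SeminormedAddCommGroup (HsRad s) :=
  SeminormedAddCommGroup.induced (HsRad s) (lp (fun _ : ℕ => ℂ) 2) (HsRad.toEll2 s)

theorem HsRad.norm_sq_eq {s : ℝ} (u : HsRad s) :
    ‖u‖ ^ 2 = ∑' n, ‖coord s u.toL2 n‖ ^ 2 := by
  have h := lp.norm_rpow_eq_tsum (p := 2) (by norm_num) (HsRad.toEll2 s u)
  simp only [ENNReal.toReal_ofNat, Real.rpow_ofNat] at h
  exact h

/-- The Borel sigma-algebra of `H^s_rad(Θ)`. -/
instance (s : ℝ) : MeasurableSpace (HsRad s) := borel (HsRad s)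

instance (s : ℝ) : BorelSpace (HsRad s) := ⟨rfl⟩

/-- The projection `S_N u = ∑_{n ≤ N} ⟨u, e_n⟩ e_n` on the first `N` modes. -/
def proj (N : ℕ) (u : L2Disc) : L2Disc :=
  ∑ n ∈ Finset.range N, (inner ℂ (eigen n) u : ℂ) • eigen n

/-! ### The free measure and the Gibbs measure -/

/-- The law of a normalised complex Gaussian `(h + i l) / √2`, with `h`, `l` independent
standard real Gaussians. -/
def complexGaussian : Measure ℂ :=
  ((gaussianReal 0 1).prod (gaussianReal 0 1)).map
    (fun p : ℝ × ℝ => ((Real.sqrt 2)⁻¹ : ℂ) * ((p.1 : ℂ) + Complex.I * (p.2 : ℂ)))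

instance : IsProbabilityMeasure complexGaussian :=
  Measure.isProbabilityMeasure_map (by fun_prop)

/-- The joint law of an i.i.d. sequence `(g_n)` of normalised complex Gaussians. -/
def gaussianSequence : Measure (ℕ → ℂ) := Measure.infinitePi fun _ : ℕ => complexGaussian

open Classical in
/-- The random series `φ = ∑ (g_n / z_n) e_n` with values in `H^s_rad(Θ)`; it is given the
value `0` on the (null, for `s < 1/2`) set where the sum is not in `H^s_rad(Θ)`. -/
def randomSeries (s : ℝ) (g : ℕ → ℂ) : HsRad s :=
  if h : (∑' n, (g n / (besselZero n : ℂ)) • eigen n) ∈ hsSubmodule s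
  then ⟨∑' n, (g n / (besselZero n : ℂ)) • eigen n, h⟩ else 0

/-- The free (Gaussian) measure `μ` on `H^s_rad(Θ)`: the law of the random series `φ`. -/
def freeMeasure (s : ℝ) : Measure (HsRad s) := gaussianSequence.map (randomSeries s)

/-- The integral `∫_Θ V(u)`. -/
def potential (V : ℂ → ℝ) (u : L2Disc) : ℝ := ∫ x, V (u x) ∂discMeasure

open Classical in
/-- The Gibbs measure `dρ(u) = χ(‖u‖_{L²(Θ)}) exp(-∫_Θ V(u)) dμ(u)`; the density is `0` where
`∫_Θ V(u)` is not finite. -/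
def gibbsMeasure (s : ℝ) (V : ℂ → ℝ) (χ : ℝ → ℝ) : Measure (HsRad s) :=
  (freeMeasure s).withDensity fun u =>
    if Integrable (fun x => V (u.toL2 x)) discMeasure then
      ENNReal.ofReal (χ ‖u.toL2‖ * Real.exp (-potential V u.toL2))
    else 0

end DiscNLS

end

noncomputable section

namespace DiscNLS

/-! ### The Bessel equation -/

/-! Everything reduces to one sixth-moment estimate. Since `α < 4`, the potential grows at most like
the sixth power and its first derivatives like the fifth, so `|V a - V b| ≤ C |a - b| (1 + |a| +
|b|)^5`. Integrability and convergence then follow once `u - S_N u` is small in `L^6` of the disc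
times the probability space.

For fixed `x` the block of modes `M ≤ n < N` of the series is a complex Gaussian sum with
coefficients `e_n(x) / z_n`, and its sixth moment is at most a constant times the cube of the
variance. The eigenfunctions satisfy `e_n(x)² ≲ z_n^{1/2} |x|^{-1/2}`, so the variance is `≲
|x|^{-1/2} ∑ z_n^{-3/2}`. The sum converges because the zeros are uniformly separated, and the cube
`|x|^{-3/2}` is integrable on the disc. Hence the sixth moment of the block is `≲ τ_M³`, where `τ_M`
is the tail of `∑ z_n^{-3/2}` (`exists_lintegral_gaussian_sum_le`), and Fatou passes to the full
field. A weighted Young inequality turns this into an `L¹` error of order `√τ_N`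
(`tendsto_eLpNorm_potential_sub`).

The facts on `J₀` come from `w = √x J₀`, a solution of `w'' + (1 + 1/(4x²)) w = 0`. Its energy `w² +
w'²` stays between two positive constants on `[1, ∞)` (`besselF_bounds`). This gives decay of `J₀`,
separation of its zeros, and a lower bound for `J₀'` at the zeros, hence for the normalising
constants; Sturm comparison gives infinitely many zeros.

For the Gibbs measure, the density is almost surely positive wherever `χ(‖u‖) ≠ 0`. That set
contains an `L²` annulus, and every annulus has positive free measure
(`freeMeasure_annulus_ne_zero`): a box condition on finitely many modes is independent of the
remaining modes, whose mean square is small. -/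

/-- The first derivative of `J₀`. -/
def besselD (x : ℝ) : ℝ :=
  Real.pi⁻¹ * ∫ θ in (0 : ℝ)..Real.pi, -(Real.sin θ * Real.sin (x * Real.sin θ))

/-- The second derivative of `J₀`. -/
def besselDD (x : ℝ) : ℝ :=
  Real.pi⁻¹ * ∫ θ in (0 : ℝ)..Real.pi, -(Real.sin θ ^ 2 * Real.cos (x * Real.sin θ))

theorem hasDerivAt_besselJ0 (x : ℝ) : HasDerivAt besselJ0 (besselD x) x := by
  unfold besselJ0 besselD
  refine HasDerivAt.const_mul _ ?_
  refine (intervalIntegral.hasDerivAt_integral_of_dominated_loc_of_deriv_le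
    (F := fun x θ => Real.cos (x * Real.sin θ))
    (F' := fun x θ => -(Real.sin θ * Real.sin (x * Real.sin θ)))
    (bound := fun _ => 1) (s := Set.univ) univ_mem ?_ ?_ ?_ ?_ ?_ ?_).2
  · exact Eventually.of_forall fun y => (by fun_prop : Continuous _).aestronglyMeasurable
  · exact (by fun_prop : Continuous _).intervalIntegrable _ _
  · exact (by fun_prop : Continuous _).aestronglyMeasurable
  · refine Eventually.of_forall fun θ _ y _ => ?_
    rw [norm_neg, norm_mul, Real.norm_eq_abs, Real.norm_eq_abs]
    exact mul_le_one₀ (Real.abs_sin_le_one _) (abs_nonneg _) (Real.abs_sin_le_one _)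
  · simp
  · refine Eventually.of_forall fun θ _ y _ => ?_
    have h := (Real.hasDerivAt_cos (y * Real.sin θ)).comp y
      ((hasDerivAt_id y).mul_const (Real.sin θ))
    simp only [Function.comp_def, id] at h
    exact h.congr_deriv (by ring)

theorem hasDerivAt_besselD (x : ℝ) : HasDerivAt besselD (besselDD x) x := by
  unfold besselD besselDD
  refine HasDerivAt.const_mul _ ?_
  refine (intervalIntegral.hasDerivAt_integral_of_dominated_loc_of_deriv_le
    (F := fun x θ => -(Real.sin θ * Real.sin (x * Real.sin θ)))
    (F' := fun x θ => -(Real.sin θ ^ 2 * Real.cos (x * Real.sin θ)))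
    (bound := fun _ => 1) (s := Set.univ) univ_mem ?_ ?_ ?_ ?_ ?_ ?_).2
  · exact Eventually.of_forall fun y => (by fun_prop : Continuous _).aestronglyMeasurable
  · exact (by fun_prop : Continuous _).intervalIntegrable _ _
  · exact (by fun_prop : Continuous _).aestronglyMeasurable
  · refine Eventually.of_forall fun θ _ y _ => ?_
    rw [norm_neg, norm_mul, norm_pow, Real.norm_eq_abs, Real.norm_eq_abs]
    exact mul_le_one₀ (pow_le_one₀ (abs_nonneg _) (Real.abs_sin_le_one _)) (abs_nonneg _)
      (Real.abs_cos_le_one _)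
  · simp
  · refine Eventually.of_forall fun θ _ y _ => ?_
    have h := ((Real.hasDerivAt_sin (y * Real.sin θ)).comp y
      ((hasDerivAt_id y).mul_const (Real.sin θ))).const_mul (Real.sin θ) |>.neg
    simp only [Function.comp_def, id] at h
    exact h.congr_deriv (by ring)

/-- The combined integrand is the `θ`-derivative of `cos θ sin(x sin θ)`, which vanishes at `0` and
at `π`. -/
theorem bessel_equation (x : ℝ) : x * besselDD x + besselD x + x * besselJ0 x = 0 := by
  have hd : ∀ θ ∈ Set.uIcc 0 Real.pi, HasDerivAt (fun θ => Real.cos θ * Real.sin (x * Real.sin θ))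
      (x * -(Real.sin θ ^ 2 * Real.cos (x * Real.sin θ)) +
        -(Real.sin θ * Real.sin (x * Real.sin θ)) + x * Real.cos (x * Real.sin θ)) θ := by
    intro θ _
    have h := (Real.hasDerivAt_cos θ).mul ((Real.hasDerivAt_sin (x * Real.sin θ)).comp θ
      ((Real.hasDerivAt_sin θ).const_mul x))
    simp only [Function.comp_def] at h
    refine h.congr_deriv ?_
    rw [Real.sin_sq]
    ring
  have h := intervalIntegral.integral_eq_sub_of_hasDerivAt hd
    ((by fun_prop : Continuous _).intervalIntegrable _ _)
  rw [intervalIntegral.integral_add, intervalIntegral.integral_add,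
    intervalIntegral.integral_const_mul, intervalIntegral.integral_const_mul] at h
  · simp only [Real.sin_pi, Real.sin_zero, mul_zero, sub_zero] at h
    unfold besselDD besselD besselJ0
    linear_combination Real.pi⁻¹ * h
  all_goals exact (by fun_prop : Continuous _).intervalIntegrable _ _

/-- Here `|x sin θ| ≤ 1 < π/2`, so the integrand is positive. This places all positive zeros in `(1,
∞)`, where the energy bounds apply, and makes the energy at `1` positive. -/
theorem besselJ0_pos {x : ℝ} (h0 : 0 ≤ x) (h1 : x ≤ 1) : 0 < besselJ0 x := by
  unfold besselJ0
  refine mul_pos (inv_pos.2 Real.pi_pos) ?_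
  refine intervalIntegral.intervalIntegral_pos_of_pos
    ((by fun_prop : Continuous _).intervalIntegrable _ _) (fun θ => ?_) Real.pi_pos
  have h2 : |x * Real.sin θ| ≤ 1 := by
    rw [abs_mul, abs_of_nonneg h0]
    exact mul_le_one₀ h1 (abs_nonneg _) (Real.abs_sin_le_one _)
  have hpi := Real.pi_gt_three
  obtain ⟨h3, h4⟩ := abs_le.1 h2
  exact Real.cos_pos_of_mem_Ioo ⟨by linarith, by linarith⟩

/-! ### The Liouville normal form -/

/-- `w(x) = √x J₀(x)`, a solution of `w'' + (1 + 1 / (4x²)) w = 0`. -/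
def besselW (x : ℝ) : ℝ := Real.sqrt x * besselJ0 x

/-- The derivative of `besselW`. -/
def besselW' (x : ℝ) : ℝ := Real.sqrt x * (besselD x + besselJ0 x / (2 * x))

theorem hasDerivAt_besselW {x : ℝ} (hx : 0 < x) : HasDerivAt besselW (besselW' x) x := by
  have h := (Real.hasDerivAt_sqrt hx.ne').mul (hasDerivAt_besselJ0 x)
  refine h.congr_deriv ?_
  have hs : x = Real.sqrt x ^ 2 := (Real.sq_sqrt hx.le).symm
  have hs0 : 0 < Real.sqrt x := Real.sqrt_pos.2 hx
  unfold besselW'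
  generalize besselD x = d
  generalize besselJ0 x = j
  generalize Real.sqrt x = q at *
  subst hs
  field_simp
  ring

theorem hasDerivAt_besselW' {x : ℝ} (hx : 0 < x) :
    HasDerivAt besselW' (-(1 + 1 / (4 * x ^ 2)) * besselW x) x := by
  have h := (Real.hasDerivAt_sqrt hx.ne').mul ((hasDerivAt_besselD x).add
    ((hasDerivAt_besselJ0 x).div ((hasDerivAt_id x).const_mul 2) (by simpa using hx.ne')))
  refine h.congr_deriv ?_
  have hs : x = Real.sqrt x ^ 2 := (Real.sq_sqrt hx.le).symm
  have hs0 : 0 < Real.sqrt x := Real.sqrt_pos.2 hx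
  have hD : besselDD x = -(besselD x + x * besselJ0 x) / x := by
    rw [eq_div_iff hx.ne']
    linear_combination bessel_equation x
  unfold besselW
  simp only [id, Pi.add_apply, Pi.div_apply, hD]
  generalize Real.sqrt x = q at *
  generalize besselJ0 x = j
  generalize besselD x = d
  subst hs
  field_simp
  ring

/-- The energy `w² + w'²`. -/
def besselF (x : ℝ) : ℝ := besselW x ^ 2 + besselW' x ^ 2

theorem hasDerivAt_besselF {x : ℝ} (hx : 0 < x) :
    HasDerivAt besselF (-(2 * besselW x * besselW' x) / (4 * x ^ 2)) x := by
  have h := ((hasDerivAt_besselW hx).pow 2).add ((hasDerivAt_besselW' hx).pow 2)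
  refine h.congr_deriv ?_
  field_simp
  ring

/-- Only the perturbation `1/(4x²)` changes the energy, so `|F'| ≤ F/(4x²)`. Thus `F e^{-1/(4x)}`
increases and `F e^{1/(4x)}` decreases; comparison with `x = 1` costs at most a factor `e^{±1/4}`.
-/
theorem besselF_bounds {x : ℝ} (hx : 1 ≤ x) :
    besselF 1 * Real.exp (-(1 / 4)) ≤ besselF x ∧
      besselF x ≤ besselF 1 * Real.exp (1 / 4) := by
  have hF0 : ∀ y, 0 ≤ besselF y := fun y => by unfold besselF; positivity
  have hexp : ∀ (e : ℝ) {y : ℝ}, 1 ≤ y → HasDerivAt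
      (fun y => besselF y * Real.exp (e / (4 * y)))
      ((-(2 * besselW y * besselW' y) - e * besselF y) / (4 * y ^ 2) *
        Real.exp (e / (4 * y))) y := by
    intro e y hy
    have hy0 : 0 < y := by linarith
    have h := (hasDerivAt_besselF hy0).mul (((hasDerivAt_const y e).div
      ((hasDerivAt_id y).const_mul 4) (by simpa using hy0.ne')).exp)
    refine h.congr_deriv ?_
    simp only [id, Pi.div_apply]
    field_simp
    ring
  have hab : ∀ y, |2 * besselW y * besselW' y| ≤ besselF y := fun y => by
    unfold besselF
    rw [abs_le]
    constructor <;> nlinarith [sq_nonneg (besselW y + besselW' y),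
      sq_nonneg (besselW y - besselW' y)]
  have hint : ∀ y ∈ interior (Set.Ici (1 : ℝ)), (1 : ℝ) ≤ y := fun y hy => by
    rw [interior_Ici] at hy
    exact le_of_lt hy
  have hcont : ∀ e : ℝ, ContinuousOn (fun y => besselF y * Real.exp (e / (4 * y))) (Set.Ici 1) :=
    fun e y hy => (hexp e hy).continuousAt.continuousWithinAt
  have hmono : MonotoneOn (fun y => besselF y * Real.exp (-1 / (4 * y))) (Set.Ici 1) := by
    refine monotoneOn_of_hasDerivWithinAt_nonneg (convex_Ici 1) (hcont _)
      (fun y hy => (hexp (-1) (hint y hy)).hasDerivWithinAt) fun y hy => ?_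
    have := (abs_le.1 (hab y)).2
    exact mul_nonneg (div_nonneg (by linarith) (by positivity)) (Real.exp_pos _).le
  have hanti : AntitoneOn (fun y => besselF y * Real.exp (1 / (4 * y))) (Set.Ici 1) := by
    refine antitoneOn_of_hasDerivWithinAt_nonpos (convex_Ici 1) (hcont _)
      (fun y hy => (hexp 1 (hint y hy)).hasDerivWithinAt) fun y hy => ?_
    have := (abs_le.1 (hab y)).1
    exact mul_nonpos_of_nonpos_of_nonneg
      (div_nonpos_of_nonpos_of_nonneg (by linarith) (by positivity)) (Real.exp_pos _).le
  have h1 := hmono (Set.mem_Ici.2 le_rfl) hx hx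
  have h2 := hanti (Set.mem_Ici.2 le_rfl) hx hx
  simp only [mul_one] at h1 h2
  have hx0 : 0 < x := by linarith
  constructor
  · calc _ = besselF 1 * Real.exp (-1 / 4) := by norm_num
      _ ≤ _ := h1
      _ ≤ besselF x * 1 := by
        refine mul_le_mul_of_nonneg_left ?_ (hF0 x)
        exact Real.exp_le_one_iff.2 (div_nonpos_of_nonpos_of_nonneg (by norm_num) (by positivity))
      _ = _ := mul_one _
  · calc _ = besselF x * 1 := (mul_one _).symm
      _ ≤ besselF x * Real.exp (1 / (4 * x)) := by
        refine mul_le_mul_of_nonneg_left ?_ (hF0 x)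
        exact Real.one_le_exp (by positivity)
      _ ≤ _ := h2

theorem besselF_one_pos : 0 < besselF 1 := by
  have h : 0 < besselW 1 := by
    simpa [besselW] using besselJ0_pos zero_le_one le_rfl
  unfold besselF
  positivity

theorem besselJ0_ne_zero_of_le_one {x : ℝ} (h0 : 0 ≤ x) (h : besselJ0 x = 0) : 1 < x := by
  by_contra! h1
  exact (besselJ0_pos h0 h1).ne' h

theorem mul_besselD_sq_of_zero {x : ℝ} (h0 : 0 ≤ x) (h : besselJ0 x = 0) :
    x * besselD x ^ 2 = besselF x := by
  simp [besselF, besselW, besselW', h, mul_pow, Real.sq_sqrt h0]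

/-- The energy bound gives decay `x^{-1/2}` for `x ≥ 1`, and `|J₀| ≤ 1` covers `x ≤ 1`. The weaker
exponent `1/4` is deliberate: exponent `p` leads to the singularity `|x|^{-6p}` in the sixth moment,
integrable on the disc only for `p < 1/3`, while any `p > 0` makes the sum over modes converge. -/
theorem abs_besselJ0_le : ∃ C : ℝ, 0 < C ∧
    ∀ x : ℝ, 0 < x → |besselJ0 x| ≤ C * x ^ (-(1 / 4) : ℝ) := by
  refine ⟨1 + besselF 1 * Real.exp (1 / 4),
    by have := besselF_one_pos; positivity, fun x hx => ?_⟩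
  have hp := besselF_one_pos
  rcases le_total x 1 with h1 | h1
  · calc |besselJ0 x| ≤ 1 * 1 := by simpa using abs_besselJ0_le_one x
      _ ≤ _ := by
        refine mul_le_mul (le_add_of_nonneg_right (by positivity))
          (Real.one_le_rpow_of_pos_of_le_one_of_nonpos hx h1 (by norm_num)) zero_le_one
          (by positivity)
  · have h2 : x * besselJ0 x ^ 2 ≤ besselF 1 * Real.exp (1 / 4) := by
      refine le_trans ?_ (besselF_bounds h1).2
      unfold besselF besselW
      rw [mul_pow, Real.sq_sqrt hx.le]
      exact le_add_of_nonneg_right (sq_nonneg _)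
    set K := besselF 1 * Real.exp (1 / 4) with hK
    have hK0 : 0 < K := by positivity
    have h3 : |besselJ0 x| ≤ (1 + K) * x ^ (-(1 / 2) : ℝ) := by
      refine abs_le_of_sq_le_sq ?_ (by positivity)
      rw [mul_pow, ← Real.rpow_natCast (x ^ (-(1 / 2) : ℝ)) 2, ← Real.rpow_mul hx.le]
      norm_num
      rw [Real.rpow_neg_one, ← div_eq_mul_inv, le_div_iff₀ hx]
      nlinarith
    refine h3.trans ?_
    exact mul_le_mul_of_nonneg_left (Real.rpow_le_rpow_of_exponent_le h1 (by norm_num))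
      (by positivity)

/-! ### The zeros of `J₀` -/

/-- Sturm comparison of `w` with `sin(x - b)` on `[b, b + π]`. The Wronskian goes from `-w(b)` to
`w(b + π)`, but its derivative has the sign opposite to `w`; this is impossible if `w` keeps one
sign. -/
theorem exists_besselJ0_zero {a : ℝ} (ha : 0 < a) : ∃ x, a < x ∧ besselJ0 x = 0 := by
  by_contra! hne
  set b := a + 1 with hb
  have hb0 : 0 < b := by linarith
  have hpi := Real.pi_pos
  have hJ : Continuous besselJ0 := continuous_besselJ0
  have hsign : (∀ x ∈ Set.Ioi a, 0 < besselJ0 x) ∨ (∀ x ∈ Set.Ioi a, besselJ0 x < 0) := by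
    by_contra! hcon
    obtain ⟨⟨x, hx, hx'⟩, y, hy, hy'⟩ := hcon
    obtain ⟨c, hc, hc'⟩ := (isPreconnected_Ioi (a := a)).intermediate_value hx hy
      hJ.continuousOn ⟨hx', hy'⟩
    exact hne c hc hc'
  have hW : ∀ x ∈ Set.Icc b (b + Real.pi), HasDerivAt
      (fun x => besselW' x * Real.sin (x - b) - besselW x * Real.cos (x - b))
      (-(1 / (4 * x ^ 2)) * besselW x * Real.sin (x - b)) x := by
    intro x hx
    have hx0 : 0 < x := lt_of_lt_of_le hb0 hx.1
    have hs := (Real.hasDerivAt_sin (x - b)).comp x ((hasDerivAt_id x).sub_const b)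
    have hc := (Real.hasDerivAt_cos (x - b)).comp x ((hasDerivAt_id x).sub_const b)
    have h := ((hasDerivAt_besselW' hx0).mul hs).sub ((hasDerivAt_besselW hx0).mul hc)
    refine h.congr_deriv ?_
    simp only [Function.comp_def, id]
    ring
  have hsin : ∀ x ∈ Set.Icc b (b + Real.pi), 0 ≤ Real.sin (x - b) := fun x hx =>
    Real.sin_nonneg_of_nonneg_of_le_pi (by linarith [hx.1]) (by linarith [hx.2])
  have hcont : ContinuousOn
      (fun x => besselW' x * Real.sin (x - b) - besselW x * Real.cos (x - b))
      (Set.Icc b (b + Real.pi)) := fun x hx => (hW x hx).continuousAt.continuousWithinAt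
  have hm1 : b ∈ Set.Icc b (b + Real.pi) := ⟨le_rfl, by linarith⟩
  have hm2 : b + Real.pi ∈ Set.Icc b (b + Real.pi) := ⟨by linarith, le_rfl⟩
  have hsq : ∀ x, b ≤ x → 0 < Real.sqrt x := fun x hx => Real.sqrt_pos.2 (by linarith)
  rcases hsign with hpos | hneg
  · have hw : ∀ x, b ≤ x → 0 < besselW x := fun x hx =>
      mul_pos (hsq x hx) (hpos x (show a < x by linarith))
    have h := antitoneOn_of_hasDerivWithinAt_nonpos (convex_Icc b (b + Real.pi)) hcont
      (fun x hx => (hW x (interior_subset hx)).hasDerivWithinAt) (fun x hx => by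
        have hx := interior_subset hx
        have h1 := mul_nonneg (mul_nonneg (by positivity : 0 ≤ 1 / (4 * x ^ 2)) (hw x hx.1).le)
          (hsin x hx)
        linarith) hm1 hm2 (by linarith)
    have h1 := hw b le_rfl
    have h2 := hw (b + Real.pi) (by linarith)
    simp at h
    linarith
  · have hw : ∀ x, b ≤ x → besselW x < 0 := fun x hx =>
      mul_neg_of_pos_of_neg (hsq x hx) (hneg x (show a < x by linarith))
    have h := monotoneOn_of_hasDerivWithinAt_nonneg (convex_Icc b (b + Real.pi)) hcont
      (fun x hx => (hW x (interior_subset hx)).hasDerivWithinAt) (fun x hx => by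
        have hx := interior_subset hx
        have h1 := mul_nonneg (mul_nonneg (by positivity : 0 ≤ 1 / (4 * x ^ 2))
          (neg_nonneg.2 (hw x hx.1).le)) (hsin x hx)
        linarith) hm1 hm2 (by linarith)
    have h1 := hw b le_rfl
    have h2 := hw (b + Real.pi) (by linarith)
    simp at h
    linarith

theorem exists_besselJ0_zero_spacing : ∃ δ : ℝ, 0 < δ ∧ δ ≤ 1 ∧ ∀ x y : ℝ, 0 < x → x < y →
    besselJ0 x = 0 → besselJ0 y = 0 → x + δ ≤ y := by
  have hF1 := besselF_one_pos
  set c := Real.sqrt (besselF 1 * Real.exp (-(1 / 4))) with hc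
  set K := Real.sqrt (besselF 1 * Real.exp (1 / 4)) with hK
  have hc0 : 0 < c := Real.sqrt_pos.2 (by positivity)
  have hK0 : 0 < K := Real.sqrt_pos.2 (by positivity)
  -- At a zero `|w'| ≥ c`, by Rolle `w'` vanishes before the next zero, and `|w''| ≤ 2K`; so the gap
  -- is at least `c/(2K)`. The cap `1` lets the linear lower bound on the zeros start from `z_1 >
  -- 1`.
  refine ⟨min 1 (c / (2 * K)), lt_min one_pos (by positivity), min_le_left _ _, ?_⟩
  intro x y hx hxy hJx hJy
  have hx1 : 1 < x := besselJ0_ne_zero_of_le_one hx.le hJx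
  have hbound : ∀ t, 1 ≤ t → |besselW t| ≤ K := fun t ht => by
    refine Real.abs_le_sqrt (le_trans ?_ (besselF_bounds ht).2)
    unfold besselF
    exact le_add_of_nonneg_right (sq_nonneg _)
  obtain ⟨ξ, hξ, hξ'⟩ := exists_hasDerivAt_eq_zero (f := besselW) (f' := besselW') hxy
    (fun t ht => (hasDerivAt_besselW (by linarith [ht.1])).continuousAt.continuousWithinAt)
    (by simp [besselW, hJx, hJy])
    (fun t ht => hasDerivAt_besselW (by linarith [ht.1]))
  have hlip : ‖besselW' ξ - besselW' x‖ ≤ 2 * K * ‖ξ - x‖ := by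
    refine Convex.norm_image_sub_le_of_norm_hasDerivWithin_le
      (f' := fun t => -(1 + 1 / (4 * t ^ 2)) * besselW t) (s := Set.Icc x ξ)
      (fun t ht => (hasDerivAt_besselW' (by linarith [ht.1])).hasDerivWithinAt)
      (fun t ht => ?_) (convex_Icc _ _) ⟨le_rfl, hξ.1.le⟩ ⟨hξ.1.le, le_rfl⟩
    have ht1 : 1 ≤ t := by linarith [ht.1]
    rw [norm_mul, norm_neg, Real.norm_eq_abs, Real.norm_eq_abs, abs_of_pos (by positivity)]
    refine mul_le_mul ?_ (hbound t ht1) (abs_nonneg _) (by norm_num)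
    have : 1 / (4 * t ^ 2) ≤ 1 := by
      rw [div_le_one (by positivity)]
      nlinarith
    linarith
  have hlow : c ≤ |besselW' x| := by
    refine Real.sqrt_le_iff.2 ⟨abs_nonneg _, ?_⟩
    have h := (besselF_bounds hx1.le).1
    rw [sq_abs]
    have h0 : besselW x = 0 := by simp [besselW, hJx]
    rw [show besselF x = besselW' x ^ 2 by rw [besselF, h0]; ring] at h
    exact h
  rw [hξ', zero_sub, norm_neg, Real.norm_eq_abs, Real.norm_eq_abs,
    abs_of_pos (by linarith [hξ.1] : 0 < ξ - x)] at hlip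
  have : c / (2 * K) ≤ ξ - x := by
    rw [div_le_iff₀ (by positivity)]
    linarith
  linarith [hξ.2, min_le_right 1 (c / (2 * K))]

theorem besselZero_prop (n : ℕ) : 0 < besselZero n ∧ besselJ0 (besselZero n) = 0 := by
  have hclosed : IsClosed {x : ℝ | besselJ0 x = 0} :=
    isClosed_eq continuous_besselJ0 continuous_const
  -- The infimum is attained because the strict condition `a < x` can be replaced by a closed one `b
  -- ≤ x`: with `b = 1` for the first zero, and by the gap `δ` for the later ones.
  have key : ∀ a b : ℝ, 0 < b → {x : ℝ | a < x ∧ besselJ0 x = 0} =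
      Set.Ici b ∩ {x : ℝ | besselJ0 x = 0} →
      sInf {x : ℝ | a < x ∧ besselJ0 x = 0} ∈ Set.Ici b ∩ {x : ℝ | besselJ0 x = 0} := by
    intro a b hb hab
    rw [hab]
    refine (isClosed_Ici.inter hclosed).csInf_mem ?_ ⟨b, fun x hx => hx.1⟩
    obtain ⟨x, hx, hx'⟩ := exists_besselJ0_zero hb
    exact ⟨x, hx.le, hx'⟩
  induction n with
  | zero =>
    have h := key 0 1 one_pos (by
      ext x
      exact ⟨fun h => ⟨(besselJ0_ne_zero_of_le_one h.1.le h.2).le, h.2⟩,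
        fun h => ⟨lt_of_lt_of_le one_pos h.1, h.2⟩⟩)
    exact ⟨lt_of_lt_of_le one_pos h.1, h.2⟩
  | succ n ih =>
    obtain ⟨δ, hδ, _, hsp⟩ := exists_besselJ0_zero_spacing
    have h := key (besselZero n) (besselZero n + δ) (by linarith [ih.1]) (by
      ext x
      exact ⟨fun h => ⟨hsp _ _ ih.1 h.1 ih.2 h.2, h.2⟩,
        fun h => ⟨lt_of_lt_of_le (by linarith) h.1, h.2⟩⟩)
    exact ⟨lt_of_lt_of_le (by linarith [ih.1]) h.1, h.2⟩

theorem besselZero_pos (n : ℕ) : 0 < besselZero n := (besselZero_prop n).1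

theorem besselJ0_besselZero (n : ℕ) : besselJ0 (besselZero n) = 0 := (besselZero_prop n).2

theorem one_lt_besselZero (n : ℕ) : 1 < besselZero n :=
  besselJ0_ne_zero_of_le_one (besselZero_pos n).le (besselJ0_besselZero n)

theorem besselZero_lt_succ (n : ℕ) : besselZero n < besselZero (n + 1) := by
  obtain ⟨δ, hδ, _, hsp⟩ := exists_besselJ0_zero_spacing
  have hn := besselZero_prop n
  obtain ⟨x, hx, hx'⟩ := exists_besselJ0_zero hn.1
  have : besselZero n + δ ≤ besselZero (n + 1) :=
    le_csInf ⟨x, hx, hx'⟩ fun y hy => hsp _ _ hn.1 hy.1 hn.2 hy.2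
  linarith

theorem strictMono_besselZero : StrictMono besselZero :=
  strictMono_nat_of_lt_succ besselZero_lt_succ

theorem exists_le_besselZero : ∃ δ : ℝ, 0 < δ ∧ ∀ n : ℕ, δ * ((n : ℝ) + 1) ≤ besselZero n := by
  obtain ⟨δ, hδ, hδ1, hsp⟩ := exists_besselJ0_zero_spacing
  refine ⟨δ, hδ, fun n => ?_⟩
  induction n with
  | zero =>
    have := one_lt_besselZero 0
    simp
    linarith
  | succ n ih =>
    have h := hsp _ _ (besselZero_pos n) (besselZero_lt_succ n) (besselJ0_besselZero n)
      (besselJ0_besselZero (n + 1))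
    push_cast
    linarith

theorem summable_besselZero_rpow {p : ℝ} (hp : p < -1) :
    Summable fun n => besselZero n ^ p := by
  obtain ⟨δ, hδ, h⟩ := exists_le_besselZero
  have h1 : Summable fun n : ℕ => (((n + 1 : ℕ) : ℝ)) ^ p :=
    (summable_nat_add_iff 1).2 (Real.summable_nat_rpow.2 hp)
  refine Summable.of_nonneg_of_le (fun n => Real.rpow_nonneg (besselZero_pos n).le _)
    (fun n => ?_) (h1.mul_left (δ ^ p))
  rw [← Real.mul_rpow hδ.le (by positivity)]
  push_cast
  exact Real.rpow_le_rpow_of_nonpos (by positivity) (h n) (by linarith)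

/-! ### Radial integrals and the radial Dirichlet eigenfunctions -/

/-- The constant of polar coordinates, `2π`. -/
def polarConst : ℝ := 2 * (volume : Measure (EuclideanSpace ℝ (Fin 2))).real (Metric.ball 0 1)

theorem polarConst_pos : 0 < polarConst := by
  unfold polarConst
  have : 0 < (volume : Measure (EuclideanSpace ℝ (Fin 2))).real (Metric.ball 0 1) :=
    ENNReal.toReal_pos (Metric.measure_ball_pos _ _ one_pos).ne' measure_ball_lt_top.ne
  positivity

theorem integral_discMeasure_norm (f : ℝ → ℝ) :
    ∫ x, f ‖x‖ ∂discMeasure = polarConst * ∫ r in (0 : ℝ)..1, r * f r := by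
  have h1 : ∫ x, f ‖x‖ ∂discMeasure =
      ∫ x : EuclideanSpace ℝ (Fin 2), (Set.Iio 1).indicator f ‖x‖ := by
    rw [discMeasure, disc, ← integral_indicator Metric.isOpen_ball.measurableSet]
    congr 1
    ext x
    by_cases hx : ‖x‖ < 1 <;> simp [Set.indicator, hx]
  rw [h1, integral_fun_norm_addHaar, intervalIntegral.integral_of_le zero_le_one,
    integral_Ioc_eq_integral_Ioo, polarConst]
  have h2 : ∫ y in Set.Ioi (0 : ℝ), y ^ (Module.finrank ℝ (EuclideanSpace ℝ (Fin 2)) - 1) •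
      (Set.Iio 1).indicator f y = ∫ r in Set.Ioo (0 : ℝ) 1, r * f r := by
    rw [← integral_indicator measurableSet_Ioi, ← integral_indicator measurableSet_Ioo]
    congr 1
    ext y
    by_cases h0 : 0 < y <;> by_cases h1 : y < 1 <;> simp [Set.indicator, h0, h1]
  rw [h2]
  simp
  ring

/-- The exponent is that of the cubed variance `(|x|^{-1/2})³`; the polar Jacobian leaves
`r^{-1/2}`. -/
theorem lintegral_discMeasure_norm_rpow_lt_top :
    ∫⁻ x, ENNReal.ofReal (‖x‖ ^ (-(3 / 2) : ℝ)) ∂discMeasure < ⊤ := by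
  have h : IntegrableOn (fun x : EuclideanSpace ℝ (Fin 2) => ‖x‖ ^ (-(3 / 2) : ℝ))
      (Metric.ball 0 1) volume := by
    rw [integrableOn_fun_norm_addHaar volume (f := fun r : ℝ => r ^ (-(3 / 2) : ℝ))]
    have h1 : IntegrableOn (fun r : ℝ => r ^ (-(1 / 2) : ℝ)) (Set.Ioo 0 1) :=
      (intervalIntegrable_iff_integrableOn_Ioo_of_le zero_le_one).1
        (intervalIntegral.intervalIntegrable_rpow' (by norm_num))
    refine h1.congr_fun (fun r hr => ?_) measurableSet_Ioo
    have hr0 : 0 < r := hr.1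
    simp only [finrank_euclideanSpace, Fintype.card_fin, Nat.add_one_sub_one, pow_one, smul_eq_mul]
    nth_rewrite 2 [← Real.rpow_one r]
    rw [← Real.rpow_add hr0]
    norm_num
  rw [discMeasure, disc]
  exact h.lintegral_lt_top

/-- Lommel's identity: the integrand is the derivative of `r` times the Wronskian of `J₀(ar)` and
`J₀(br)`. At two zeros the right side vanishes, which gives orthogonality. -/
theorem integral_mul_besselJ0_mul (a b : ℝ) :
    (a ^ 2 - b ^ 2) * ∫ r in (0 : ℝ)..1, r * (besselJ0 (a * r) * besselJ0 (b * r)) =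
      b * besselJ0 a * besselD b - a * besselD a * besselJ0 b := by
  have hJ := continuous_besselJ0
  have hd : ∀ r ∈ Set.uIcc (0 : ℝ) 1, HasDerivAt
      (fun r => r * (b * besselJ0 (a * r) * besselD (b * r) -
        a * besselD (a * r) * besselJ0 (b * r)))
      ((a ^ 2 - b ^ 2) * (r * (besselJ0 (a * r) * besselJ0 (b * r)))) r := by
    intro r _
    have hl : ∀ c : ℝ, HasDerivAt (fun r => c * r) c r := fun c => by
      simpa using (hasDerivAt_id r).const_mul c
    have h0 : ∀ c : ℝ, HasDerivAt (fun r => besselJ0 (c * r)) (besselD (c * r) * c) r :=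
      fun c => (hasDerivAt_besselJ0 (c * r)).comp r (hl c)
    have h1 : ∀ c : ℝ, HasDerivAt (fun r => besselD (c * r)) (besselDD (c * r) * c) r :=
      fun c => (hasDerivAt_besselD (c * r)).comp r (hl c)
    have h := (hasDerivAt_id r).mul ((((h0 a).const_mul b).mul (h1 b)).sub
      (((h1 a).const_mul a).mul (h0 b)))
    refine h.congr_deriv ?_
    have ea := bessel_equation (a * r)
    have eb := bessel_equation (b * r)
    simp only [id, Pi.sub_apply, Pi.mul_apply]
    linear_combination b * besselJ0 (a * r) * eb - a * besselJ0 (b * r) * ea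
  rw [← intervalIntegral.integral_const_mul, intervalIntegral.integral_eq_sub_of_hasDerivAt hd
    ((by fun_prop : Continuous _).intervalIntegrable _ _)]
  simp

/-- By the Bessel equation, `r² (J₀'(ar)² + J₀(ar)²) / 2` is an antiderivative. -/
theorem integral_mul_besselJ0_sq (a : ℝ) :
    ∫ r in (0 : ℝ)..1, r * besselJ0 (a * r) ^ 2 = (besselD a ^ 2 + besselJ0 a ^ 2) / 2 := by
  have hJ := continuous_besselJ0
  have hd : ∀ r ∈ Set.uIcc (0 : ℝ) 1, HasDerivAt
      (fun r => r ^ 2 * (besselD (a * r) ^ 2 + besselJ0 (a * r) ^ 2) / 2)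
      (r * besselJ0 (a * r) ^ 2) r := by
    intro r _
    have hl : HasDerivAt (fun r => a * r) a r := by
      simpa using (hasDerivAt_id r).const_mul a
    have h0 : HasDerivAt (fun r => besselJ0 (a * r)) (besselD (a * r) * a) r :=
      (hasDerivAt_besselJ0 (a * r)).comp r hl
    have h1 : HasDerivAt (fun r => besselD (a * r)) (besselDD (a * r) * a) r :=
      (hasDerivAt_besselD (a * r)).comp r hl
    have h := ((hasDerivAt_pow 2 r).mul ((h1.pow 2).add (h0.pow 2))).div_const 2
    refine h.congr_deriv ?_
    have ea := bessel_equation (a * r)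
    simp only [Pi.add_apply, Pi.pow_apply]
    push_cast
    linear_combination r * besselD (a * r) * ea
  rw [intervalIntegral.integral_eq_sub_of_hasDerivAt hd
    ((by fun_prop : Continuous _).intervalIntegrable _ _)]
  simp

/-- The squared `L²` norm of `J₀(z_{n+1} |·|)` on the disc. -/
theorem integral_besselJ0_sq (n : ℕ) :
    ∫ y, besselJ0 (besselZero n * ‖y‖) ^ 2 ∂discMeasure =
      polarConst * (besselD (besselZero n) ^ 2 / 2) := by
  rw [integral_discMeasure_norm (fun r => besselJ0 (besselZero n * r) ^ 2),
    integral_mul_besselJ0_sq, besselJ0_besselZero]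
  ring

/-- At a zero the energy reduces to `z J₀'(z)²`, so its lower bound controls `J₀'(z)²` from below by
a multiple of `1/z`. -/
theorem exists_le_integral_besselJ0_sq : ∃ c : ℝ, 0 < c ∧ ∀ n,
    c / besselZero n ≤ ∫ y, besselJ0 (besselZero n * ‖y‖) ^ 2 ∂discMeasure := by
  refine ⟨polarConst * (besselF 1 * Real.exp (-(1 / 4)) / 2), ?_, fun n => ?_⟩
  · have h1 := besselF_one_pos
    have h2 := polarConst_pos
    positivity
  have hz := besselZero_pos n
  rw [integral_besselJ0_sq, div_le_iff₀ hz]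
  have h := (besselF_bounds (one_lt_besselZero n).le).1
  rw [← mul_besselD_sq_of_zero hz.le (besselJ0_besselZero n)] at h
  calc _ ≤ polarConst * (besselZero n * besselD (besselZero n) ^ 2 / 2) := by
        have := polarConst_pos
        gcongr
    _ = _ := by ring

theorem integral_besselJ0_sq_pos (n : ℕ) :
    0 < ∫ y, besselJ0 (besselZero n * ‖y‖) ^ 2 ∂discMeasure := by
  obtain ⟨c, hc, h⟩ := exists_le_integral_besselJ0_sq
  exact lt_of_lt_of_le (div_pos hc (besselZero_pos n)) (h n)

/-! ### Pointwise bounds and orthonormality of the eigenfunctions -/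

/-- The real values of the eigenfunctions. -/
def eigenReal (n : ℕ) (x : EuclideanSpace ℝ (Fin 2)) : ℝ :=
  besselJ0 (besselZero n * ‖x‖) /
    Real.sqrt (∫ y, besselJ0 (besselZero n * ‖y‖) ^ 2 ∂discMeasure)

theorem eigenFun_eq (n : ℕ) (x : EuclideanSpace ℝ (Fin 2)) :
    eigenFun n x = (eigenReal n x : ℂ) := rfl

theorem continuous_eigenReal (n : ℕ) : Continuous (eigenReal n) := by
  unfold eigenReal
  have := continuous_besselJ0
  fun_prop

/-- The decay `(z|x|)^{-1/4}` is divided by a norm of size at least `z^{-1/2}`, which leaves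
`z^{1/4}`. -/
theorem exists_abs_eigenReal_le : ∃ C : ℝ, 0 < C ∧ ∀ (n : ℕ) (x : EuclideanSpace ℝ (Fin 2)),
    x ≠ 0 → |eigenReal n x| ≤ C * (besselZero n ^ (1 / 4 : ℝ) * ‖x‖ ^ (-(1 / 4) : ℝ)) := by
  obtain ⟨C, hC, hJ⟩ := abs_besselJ0_le
  obtain ⟨c, hc, hN⟩ := exists_le_integral_besselJ0_sq
  refine ⟨C / Real.sqrt c, by positivity, fun n x hx => ?_⟩
  have hz := besselZero_pos n
  have hx0 : 0 < ‖x‖ := norm_pos_iff.2 hx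
  unfold eigenReal
  rw [abs_div, abs_of_nonneg (Real.sqrt_nonneg _),
    div_le_iff₀ (Real.sqrt_pos.2 (integral_besselJ0_sq_pos n))]
  have hz4 : besselZero n ^ (-(1 / 4) : ℝ) =
      besselZero n ^ (1 / 4 : ℝ) * Real.sqrt (1 / besselZero n) := by
    rw [Real.sqrt_eq_rpow, one_div (besselZero n), ← Real.rpow_neg_one, ← Real.rpow_mul hz.le,
      ← Real.rpow_add hz]
    norm_num
  calc |besselJ0 (besselZero n * ‖x‖)| ≤ C * (besselZero n * ‖x‖) ^ (-(1 / 4) : ℝ) :=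
        hJ _ (by positivity)
    _ = C / Real.sqrt c * (besselZero n ^ (1 / 4 : ℝ) * ‖x‖ ^ (-(1 / 4) : ℝ)) *
        Real.sqrt (c / besselZero n) := by
        rw [Real.mul_rpow hz.le hx0.le, hz4, div_eq_mul_one_div c, Real.sqrt_mul hc.le]
        have : 0 < Real.sqrt c := Real.sqrt_pos.2 hc
        field_simp
    _ ≤ _ := by
        gcongr
        exact hN n

theorem exists_eigenReal_sq_le : ∃ C : ℝ, 0 < C ∧ ∀ (n : ℕ) (x : EuclideanSpace ℝ (Fin 2)),
    x ≠ 0 → (eigenReal n x / besselZero n) ^ 2 ≤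
      C * ‖x‖ ^ (-(1 / 2) : ℝ) * besselZero n ^ (-(3 / 2) : ℝ) := by
  obtain ⟨C, hC, h⟩ := exists_abs_eigenReal_le
  refine ⟨C ^ 2, by positivity, fun n x hx => ?_⟩
  have hz := besselZero_pos n
  have hx0 : 0 < ‖x‖ := norm_pos_iff.2 hx
  rw [div_pow, div_le_iff₀ (by positivity), ← sq_abs]
  refine (pow_le_pow_left₀ (abs_nonneg _) (h n x hx) 2).trans_eq ?_
  have e1 : (‖x‖ ^ (-(1 / 4) : ℝ)) ^ 2 = ‖x‖ ^ (-(1 / 2) : ℝ) := by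
    rw [← Real.rpow_natCast, ← Real.rpow_mul hx0.le]
    norm_num
  have e2 : (besselZero n ^ (1 / 4 : ℝ)) ^ 2 =
      besselZero n ^ (-(3 / 2) : ℝ) * besselZero n ^ 2 := by
    rw [← Real.rpow_natCast, ← Real.rpow_mul hz.le, ← Real.rpow_natCast (besselZero n) 2,
      ← Real.rpow_add hz]
    norm_num
  rw [mul_pow, mul_pow, e1, e2]
  ring

theorem inner_eigen (m n : ℕ) : (inner ℂ (eigen m) (eigen n) : ℂ) =
    ((∫ x, eigenReal m x * eigenReal n x ∂discMeasure : ℝ) : ℂ) := by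
  rw [MeasureTheory.L2.inner_def, ← integral_complex_ofReal]
  refine integral_congr_ae ?_
  filter_upwards [(memLp_eigenFun m).coeFn_toLp, (memLp_eigenFun n).coeFn_toLp] with x hm hn
  rw [eigen, eigen, hm, hn, eigenFun_eq, eigenFun_eq]
  simp [mul_comm]

theorem orthonormal_eigen : Orthonormal ℂ eigen := by
  rw [orthonormal_iff_ite]
  intro m n
  have hm := integral_besselJ0_sq_pos m
  have hn := integral_besselJ0_sq_pos n
  rw [inner_eigen]
  split_ifs with h
  · subst h
    have : ∫ x, eigenReal m x * eigenReal m x ∂discMeasure = 1 := by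
      simp_rw [eigenReal, div_mul_div_comm, Real.mul_self_sqrt hm.le, ← pow_two]
      rw [integral_div, div_self hm.ne']
    rw [this]
    simp
  · have hne : besselZero m ^ 2 - besselZero n ^ 2 ≠ 0 := by
      have h1 : besselZero m ≠ besselZero n := fun h' => h (strictMono_besselZero.injective h')
      have h2 := besselZero_pos m
      have h3 := besselZero_pos n
      rw [sq_sub_sq]
      exact mul_ne_zero (by positivity) (sub_ne_zero.2 h1)
    have h0 : ∫ r in (0 : ℝ)..1, r * (besselJ0 (besselZero m * r) * besselJ0 (besselZero n * r))
        = 0 := by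
      have h1 := integral_mul_besselJ0_mul (besselZero m) (besselZero n)
      rw [besselJ0_besselZero, besselJ0_besselZero] at h1
      simpa [hne] using h1
    have : ∫ x, eigenReal m x * eigenReal n x ∂discMeasure = 0 := by
      simp_rw [eigenReal, div_mul_div_comm]
      rw [integral_div, integral_discMeasure_norm
        (fun r => besselJ0 (besselZero m * r) * besselJ0 (besselZero n * r)), h0]
      simp
    rw [this]
    simp

/-! ### Gaussian moments -/

instance : IsProbabilityMeasure gaussianSequence := by
  unfold gaussianSequence
  infer_instance

theorem iIndepFun_eval_gaussianSequence :
    iIndepFun (fun (n : ℕ) (g : ℕ → ℂ) => g n) gaussianSequence :=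
  iIndepFun_infinitePi (X := fun _ z => z) fun _ => measurable_id

theorem map_eval_gaussianSequence (n : ℕ) :
    gaussianSequence.map (fun g => g n) = complexGaussian :=
  Measure.infinitePi_map_eval (fun _ : ℕ => complexGaussian) n

theorem exists_map_re_complexGaussian :
    ∃ v : NNReal, complexGaussian.map Complex.re = gaussianReal 0 v := by
  have h : complexGaussian.map Complex.re =
      (((gaussianReal 0 1).prod (gaussianReal 0 1)).map Prod.fst).map
        (fun x : ℝ => (Real.sqrt 2)⁻¹ * x) := by
    rw [complexGaussian, Measure.map_map (by fun_prop) (by fun_prop),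
      Measure.map_map (by fun_prop) (by fun_prop)]
    congr 1
    ext p
    simp [← Complex.ofReal_inv]
  rw [h, ← Measure.fst, Measure.fst_prod, gaussianReal_map_const_mul]
  exact ⟨_, by rw [mul_zero]⟩

theorem exists_map_im_complexGaussian :
    ∃ v : NNReal, complexGaussian.map Complex.im = gaussianReal 0 v := by
  have h : complexGaussian.map Complex.im =
      (((gaussianReal 0 1).prod (gaussianReal 0 1)).map Prod.snd).map
        (fun x : ℝ => (Real.sqrt 2)⁻¹ * x) := by
    rw [complexGaussian, Measure.map_map (by fun_prop) (by fun_prop),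
      Measure.map_map (by fun_prop) (by fun_prop)]
    congr 1
    ext p
    simp [← Complex.ofReal_inv]
  rw [h, ← Measure.snd, Measure.snd_prod, gaussianReal_map_const_mul]
  exact ⟨_, by rw [mul_zero]⟩

/-- The sixth absolute moment of a standard real Gaussian. -/
def gaussianSixth : ℝ≥0∞ := ∫⁻ x, ‖x‖ₑ ^ 6 ∂gaussianReal 0 1

theorem gaussianSixth_lt_top : gaussianSixth < ⊤ := by
  have h := (memLp_id_gaussianReal (μ := 0) (v := 1) 6).eLpNorm_lt_top
  have h2 := lintegral_rpow_enorm_lt_top_of_eLpNorm_lt_top (by norm_num) (by norm_num) h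
  have e : (((6 : NNReal) : ℝ≥0∞)).toReal = ((6 : ℕ) : ℝ) := by norm_num
  rw [e] at h2
  simpa only [id, ENNReal.rpow_natCast, gaussianSixth] using h2

theorem lintegral_pow_six_gaussianReal (v : NNReal) :
    ∫⁻ x, ‖x‖ₑ ^ 6 ∂gaussianReal 0 v = (v : ℝ≥0∞) ^ 3 * gaussianSixth := by
  have h : gaussianReal 0 v = (gaussianReal 0 1).map (fun x : ℝ => Real.sqrt v * x) := by
    rw [gaussianReal_map_const_mul]
    congr 1
    · simp
    · ext
      simp
  rw [h, lintegral_map (by fun_prop) (by fun_prop)]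
  simp_rw [enorm_mul, mul_pow]
  rw [lintegral_const_mul _ (by fun_prop), gaussianSixth]
  congr 1
  rw [Real.enorm_of_nonneg (Real.sqrt_nonneg _), show 6 = 2 * 3 by norm_num, pow_mul,
    ← ENNReal.ofReal_pow (Real.sqrt_nonneg _), Real.sq_sqrt (NNReal.coe_nonneg v),
    ENNReal.ofReal_coe_nnreal]

/-- Independent centred Gaussians add up with their variances. The function `f` stands for the real
or the imaginary part. -/
theorem map_sum_gaussianSequence {f : ℂ → ℝ} (hf : Measurable f) {v : NNReal}
    (hv : complexGaussian.map f = gaussianReal 0 v) (a : ℕ → ℝ) (S : Finset ℕ) :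
    gaussianSequence.map (∑ n ∈ S, fun g : ℕ → ℂ => a n * f (g n)) =
      gaussianReal 0 ((∑ n ∈ S, Real.nnabs (a n) ^ 2) * v) := by
  induction S using Finset.induction_on with
  | empty =>
    have h : (0 : (ℕ → ℂ) → ℝ) = fun _ => 0 := rfl
    simp [h, Measure.map_const, gaussianReal_zero_var]
  | insert i S hi ih =>
    have hind : iIndepFun (fun (n : ℕ) (g : ℕ → ℂ) => a n * f (g n)) gaussianSequence :=
      iIndepFun_eval_gaussianSequence.comp (fun n z => a n * f z) fun n => by fun_prop
    have hmeas : ∀ n : ℕ, Measurable fun g : ℕ → ℂ => a n * f (g n) := fun n => by fun_prop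
    have hone : gaussianSequence.map (fun g : ℕ → ℂ => a i * f (g i)) =
        gaussianReal 0 (Real.nnabs (a i) ^ 2 * v) := by
      have h1 : gaussianSequence.map (fun g : ℕ → ℂ => a i * f (g i)) =
          ((gaussianSequence.map (fun g => g i)).map f).map (fun x => a i * x) := by
        rw [Measure.map_map hf (by fun_prop), Measure.map_map (by fun_prop) (by fun_prop)]
        rfl
      rw [h1, map_eval_gaussianSequence, hv, gaussianReal_map_const_mul, mul_zero]
      congr 2
      ext
      simp
    rw [Finset.sum_insert hi, Finset.sum_insert hi, add_comm (fun g : ℕ → ℂ => a i * f (g i)),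
      gaussianReal_add_gaussianReal_of_indepFun (hind.indepFun_finsetSum_of_notMem hmeas hi) ih hone,
      add_zero, add_comm, add_mul]

/-- The coefficients are real, so the real and imaginary parts are separately centred Gaussian, with
variance proportional to `∑ a_n²`, and a sixth moment scales as the cube of the variance. -/
theorem exists_lintegral_sum_pow_six_le : ∃ C : NNReal, ∀ (a : ℕ → ℝ) (S : Finset ℕ),
    ∫⁻ g, ‖∑ n ∈ S, (a n : ℂ) * g n‖ₑ ^ 6 ∂gaussianSequence ≤
      C * ENNReal.ofReal (∑ n ∈ S, a n ^ 2) ^ 3 := by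
  obtain ⟨v, hv⟩ := exists_map_re_complexGaussian
  obtain ⟨w, hw⟩ := exists_map_im_complexGaussian
  have key : ∀ {f : ℂ → ℝ} (hf : Measurable f) {v : NNReal}
      (hv : complexGaussian.map f = gaussianReal 0 v) (a : ℕ → ℝ) (S : Finset ℕ),
      ∫⁻ g, ‖∑ n ∈ S, a n * f (g n)‖ₑ ^ 6 ∂gaussianSequence =
        ENNReal.ofReal (∑ n ∈ S, a n ^ 2) ^ 3 * ((v : ℝ≥0∞) ^ 3 * gaussianSixth) := by
    intro f hf v hv a S
    have h := lintegral_map (μ := gaussianSequence) (f := fun x : ℝ => ‖x‖ₑ ^ 6)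
      (g := ∑ n ∈ S, fun g : ℕ → ℂ => a n * f (g n)) (by fun_prop)
      (by rw [Finset.sum_fn]; fun_prop)
    rw [map_sum_gaussianSequence hf hv, lintegral_pow_six_gaussianReal] at h
    simp only [Finset.sum_apply] at h
    rw [← h, ENNReal.coe_mul, mul_pow, mul_assoc]
    congr 2
    rw [ENNReal.ofReal]
    congr 1
    rw [← NNReal.coe_inj, Real.coe_toNNReal _ (Finset.sum_nonneg fun n _ => sq_nonneg _)]
    push_cast
    simp
  set K : ℝ≥0∞ := 2 ^ 5 * ((v : ℝ≥0∞) ^ 3 * gaussianSixth + (w : ℝ≥0∞) ^ 3 * gaussianSixth)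
    with hK
  have hKtop : K ≠ ⊤ := by
    have := gaussianSixth_lt_top.ne
    rw [hK]
    finiteness
  refine ⟨K.toNNReal, fun a S => ?_⟩
  rw [ENNReal.coe_toNNReal hKtop]
  have hpt : ∀ z : ℂ, ‖z‖ₑ ^ 6 ≤ 2 ^ 5 * (‖z.re‖ₑ ^ 6 + ‖z.im‖ₑ ^ 6) := by
    intro z
    have h1 : ‖z‖ ^ 6 ≤ 2 ^ 5 * (‖z.re‖ ^ 6 + ‖z.im‖ ^ 6) :=
      (pow_le_pow_left₀ (norm_nonneg _) (Complex.norm_le_abs_re_add_abs_im z) 6).trans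
        (add_pow_le (abs_nonneg _) (abs_nonneg _) 6)
    simp only [← ofReal_norm]
    have h2 := ENNReal.ofReal_le_ofReal h1
    rw [ENNReal.ofReal_mul (by norm_num), ENNReal.ofReal_add (by positivity) (by positivity),
      ENNReal.ofReal_pow (norm_nonneg _), ENNReal.ofReal_pow (norm_nonneg _),
      ENNReal.ofReal_pow (norm_nonneg _)] at h2
    simpa using h2
  calc ∫⁻ g, ‖∑ n ∈ S, (a n : ℂ) * g n‖ₑ ^ 6 ∂gaussianSequence
      ≤ ∫⁻ g, 2 ^ 5 * (‖∑ n ∈ S, a n * (g n).re‖ₑ ^ 6 + ‖∑ n ∈ S, a n * (g n).im‖ₑ ^ 6)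
          ∂gaussianSequence := by
        refine lintegral_mono fun g => (hpt _).trans_eq ?_
        simp [Complex.re_sum, Complex.im_sum]
    _ = K * ENNReal.ofReal (∑ n ∈ S, a n ^ 2) ^ 3 := by
        rw [lintegral_const_mul _ (by fun_prop), lintegral_add_left (by fun_prop),
          key Complex.measurable_re hv, key Complex.measurable_im hw, hK]
        ring

/-- The second absolute moment of a normalised complex Gaussian. -/
def gaussianSecond : ℝ≥0∞ := ∫⁻ z, ‖z‖ₑ ^ 2 ∂complexGaussian

theorem lintegral_enorm_sq_gaussianSequence (n : ℕ) :
    ∫⁻ g, ‖g n‖ₑ ^ 2 ∂gaussianSequence = gaussianSecond := by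
  rw [gaussianSecond, ← map_eval_gaussianSequence n, lintegral_map (by fun_prop) (by fun_prop)]

theorem gaussianSecond_lt_top : gaussianSecond < ⊤ := by
  obtain ⟨C, hC⟩ := exists_lintegral_sum_pow_six_le
  have h := hC (fun _ => 1) {0}
  simp only [Finset.sum_singleton, Complex.ofReal_one, one_mul] at h
  have hpt : ∀ t : ℝ≥0∞, t ^ 2 ≤ 1 + t ^ 6 := fun t => by
    rcases le_total t 1 with ht | ht
    · exact (pow_le_one₀ zero_le ht).trans le_self_add
    · exact (pow_le_pow_right₀ ht (by norm_num)).trans le_add_self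
  rw [← lintegral_enorm_sq_gaussianSequence 0]
  calc ∫⁻ g, ‖g 0‖ₑ ^ 2 ∂gaussianSequence ≤ ∫⁻ g, 1 + ‖g 0‖ₑ ^ 6 ∂gaussianSequence :=
        lintegral_mono fun g => hpt _
    _ = 1 + ∫⁻ g, ‖g 0‖ₑ ^ 6 ∂gaussianSequence := by
        rw [lintegral_add_left measurable_const]
        simp
    _ < ⊤ := by
        refine ENNReal.add_lt_top.2 ⟨by simp, h.trans_lt ?_⟩
        simp

theorem ae_summable_gaussianSequence {w : ℕ → ℝ} (hw0 : ∀ n, 0 ≤ w n) (hw : Summable w) :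
    ∀ᵐ g ∂gaussianSequence, Summable fun n => w n * ‖g n‖ ^ 2 := by
  have h1 : ∫⁻ g, ∑' n, ENNReal.ofReal (w n) * ‖g n‖ₑ ^ 2 ∂gaussianSequence ≠ ⊤ := by
    rw [lintegral_tsum fun n =>
      (by fun_prop : Measurable fun g : ℕ → ℂ => ENNReal.ofReal (w n) * ‖g n‖ₑ ^ 2).aemeasurable]
    simp_rw [fun n : ℕ => lintegral_const_mul (μ := gaussianSequence) (ENNReal.ofReal (w n))
      (by fun_prop : Measurable fun g : ℕ → ℂ => ‖g n‖ₑ ^ 2),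
      lintegral_enorm_sq_gaussianSequence]
    rw [ENNReal.tsum_mul_right]
    exact ENNReal.mul_ne_top hw.tsum_ofReal_ne_top gaussianSecond_lt_top.ne
  filter_upwards [ae_lt_top (by fun_prop) h1] with g hg
  have h2 : ∀ n, ENNReal.ofReal (w n) * ‖g n‖ₑ ^ 2 = ENNReal.ofReal (w n * ‖g n‖ ^ 2) := by
    intro n
    rw [ENNReal.ofReal_mul (hw0 n), ENNReal.ofReal_pow (norm_nonneg _), ofReal_norm]
  simp_rw [h2] at hg
  exact (ENNReal.summable_toReal hg.ne).congr fun n =>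
    ENNReal.toReal_ofReal (mul_nonneg (hw0 n) (sq_nonneg _))

/-! ### The spaces `H^s_rad` -/

theorem inner_eigen_tsum {c : ℕ → ℂ} (hc : Summable fun n => ‖c n‖ ^ 2) :
    HasSum (fun n => c n • eigen n) (∑' n, c n • eigen n) ∧
      ∀ m, (inner ℂ (eigen m) (∑' n, c n • eigen n) : ℂ) = c m := by
  have h1 : Summable fun n => c n • eigen n := by
    have h := orthonormal_eigen.orthogonalFamily.summable_iff_norm_sq_summable c
    simpa [LinearIsometry.toSpanSingleton_apply] using h.2 hc
  refine ⟨h1.hasSum, fun m => ?_⟩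
  have h2 := h1.hasSum.mapL (innerSL ℂ (eigen m))
  have e : (fun n => innerSL ℂ (eigen m) (c n • eigen n)) = fun n => if n = m then c m else 0 := by
    funext n
    rw [innerSL_apply_apply, inner_smul_right, orthonormal_iff_ite.1 orthonormal_eigen]
    by_cases h : m = n
    · simp [h]
    · simp [h, Ne.symm h]
  rw [e] at h2
  exact h2.unique (hasSum_ite_eq m (c m))

theorem memℓp_two_iff {c : ℕ → ℂ} : Memℓp c 2 ↔ Summable fun n => ‖c n‖ ^ 2 := by
  rw [memℓp_gen_iff (by norm_num)]
  simp

theorem norm_sq_coord (s : ℝ) (u : L2Disc) (n : ℕ) :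
    ‖coord s u n‖ ^ 2 = besselZero n ^ (2 * s) * ‖(inner ℂ (eigen n) u : ℂ)‖ ^ 2 := by
  have hz := besselZero_pos n
  rw [coord, norm_mul, mul_pow, Complex.norm_real, Real.norm_eq_abs,
    abs_of_nonneg (Real.rpow_nonneg hz.le _), ← Real.rpow_natCast, ← Real.rpow_mul hz.le]
  congr 2
  push_cast
  ring

theorem HsRad.hasSum_eigen {s : ℝ} (u : HsRad s) :
    HasSum (fun n => (inner ℂ (eigen n) u.toL2 : ℂ) • eigen n) u.toL2 :=
  u.2.1

/-- Parseval without completeness of the eigenfunctions: elements of the space are by definition the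
sums of their own expansions. -/
theorem HsRad.hasSum_norm_sq {s : ℝ} (u : HsRad s) :
    HasSum (fun n => ‖(inner ℂ (eigen n) u.toL2 : ℂ)‖ ^ 2) (‖u.toL2‖ ^ 2) := by
  have h := u.hasSum_eigen.mapL (innerSL ℂ u.toL2)
  have h2 := h.mapL Complex.reCLM
  rw [innerSL_apply_apply, inner_self_eq_norm_sq_to_K] at h2
  convert h2 using 2
  · rw [innerSL_apply_apply, inner_smul_right, ← inner_conj_symm u.toL2, Complex.reCLM_apply,
      RCLike.mul_conj]
    norm_cast
  · rw [Complex.reCLM_apply]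
    norm_cast

theorem HsRad.toL2_sub {s : ℝ} (u v : HsRad s) : (u - v).toL2 = u.toL2 - v.toL2 := rfl

theorem HsRad.norm_toL2_le {s : ℝ} (hs : 0 ≤ s) (u : HsRad s) : ‖u.toL2‖ ≤ ‖u‖ := by
  refine le_of_sq_le_sq ?_ (norm_nonneg _)
  rw [HsRad.norm_sq_eq, ← u.hasSum_norm_sq.tsum_eq]
  refine u.hasSum_norm_sq.summable.tsum_le_tsum (fun n => ?_) (memℓp_two_iff.1 u.2.2)
  rw [norm_sq_coord]
  exact le_mul_of_one_le_left (sq_nonneg _)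
    (Real.one_le_rpow (one_lt_besselZero n).le (by positivity))

theorem HsRad.continuous_toL2 {s : ℝ} (hs : 0 ≤ s) : Continuous (HsRad.toL2 (s := s)) := by
  refine LipschitzWith.continuous (K := 1) (LipschitzWith.of_dist_le_mul fun u v => ?_)
  rw [dist_eq_norm, dist_eq_norm, NNReal.coe_one, one_mul, ← HsRad.toL2_sub]
  exact HsRad.norm_toL2_le hs _

instance (s : ℝ) : NormedSpace ℂ (HsRad s) :=
  NormedSpace.induced ℂ (HsRad s) (lp (fun _ : ℕ => ℂ) 2) (HsRad.toEll2 s)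

theorem eigen_mem_hsSubmodule (s : ℝ) (m : ℕ) : eigen m ∈ hsSubmodule s := by
  have h : ∀ n, (inner ℂ (eigen n) (eigen m) : ℂ) = if n = m then 1 else 0 :=
    fun n => orthonormal_iff_ite.1 orthonormal_eigen n m
  refine ⟨?_, ?_⟩
  · simp_rw [h]
    convert hasSum_ite_eq m (eigen m) using 2 with n
    split_ifs with hn <;> simp [hn]
  · rw [memℓp_two_iff]
    refine summable_of_ne_finset_zero (s := {m}) fun n hn => ?_
    rw [norm_sq_coord, h]
    simp [Finset.notMem_singleton.1 hn]

/-- The eigenfunction `e_{n+1}` as an element of `H^s_rad`. -/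
def HsRad.eigen (s : ℝ) (n : ℕ) : HsRad s := ⟨DiscNLS.eigen n, eigen_mem_hsSubmodule s n⟩

theorem HsRad.toL2_sum_smul_eigen {s : ℝ} (c : ℕ → ℂ) (S : Finset ℕ) :
    (∑ n ∈ S, c n • HsRad.eigen s n).toL2 = ∑ n ∈ S, c n • DiscNLS.eigen n := by
  change (hsSubmodule s).subtype (∑ n ∈ S, c n • HsRad.eigen s n) = _
  exact map_sum (hsSubmodule s).subtype _ _

/-- Truncation removes the first `N` coordinates from the error and leaves the tail of a convergent
series. Convergence in the `H^s` norm itself is what measurability of the random series needs. -/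
theorem HsRad.tendsto_sum_eigen {s : ℝ} (u : HsRad s) :
    Tendsto (fun N => ∑ n ∈ Finset.range N,
      (inner ℂ (DiscNLS.eigen n) u.toL2 : ℂ) • HsRad.eigen s n) atTop (𝓝 u) := by
  have hsum : Summable fun n => ‖coord s u.toL2 n‖ ^ 2 := memℓp_two_iff.1 u.2.2
  rw [tendsto_iff_norm_sub_tendsto_zero]
  have hsq : ∀ N, ‖(∑ n ∈ Finset.range N,
      (inner ℂ (DiscNLS.eigen n) u.toL2 : ℂ) • HsRad.eigen s n) - u‖ ^ 2 =
      ∑' n, ‖coord s u.toL2 (n + N)‖ ^ 2 := by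
    intro N
    rw [HsRad.norm_sq_eq]
    have hc : ∀ n, ‖coord s ((∑ n ∈ Finset.range N,
        (inner ℂ (DiscNLS.eigen n) u.toL2 : ℂ) • HsRad.eigen s n) - u).toL2 n‖ ^ 2 =
        if n < N then 0 else ‖coord s u.toL2 n‖ ^ 2 := by
      intro n
      rw [norm_sq_coord, norm_sq_coord, HsRad.toL2_sub, HsRad.toL2_sum_smul_eigen,
        inner_sub_right, inner_sum]
      simp_rw [inner_smul_right, orthonormal_iff_ite.1 orthonormal_eigen]
      by_cases hn : n < N <;> simp [hn]
    simp_rw [hc]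
    have hs' : Summable fun n => if n < N then 0 else ‖coord s u.toL2 n‖ ^ 2 :=
      Summable.of_nonneg_of_le (fun n => by positivity)
        (fun n => by split_ifs <;> simp) hsum
    rw [← hs'.sum_add_tsum_nat_add N, Finset.sum_eq_zero, zero_add]
    · simp
    · intro n hn
      simp [Finset.mem_range.1 hn]
  have h := tendsto_sum_nat_add fun n => ‖coord s u.toL2 n‖ ^ 2
  simp_rw [← hsq] at h
  simpa using h.sqrt

/-! ### The random series -/

/-- The weight `z_n^{2s-2}` is that of the squared `H^s` norm; since `z_n > 1` and `s ≥ 0` it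
dominates the `L²` weight `z_n^{-2}`. -/
theorem randomSeries_mem {s : ℝ} (hs : 0 ≤ s) {g : ℕ → ℂ}
    (hg : Summable fun n => besselZero n ^ (2 * s - 2) * ‖g n‖ ^ 2) :
    (∑' n, (g n / (besselZero n : ℂ)) • eigen n) ∈ hsSubmodule s ∧
      ∀ m, (inner ℂ (eigen m) (∑' n, (g n / (besselZero n : ℂ)) • eigen n) : ℂ) =
        g m / besselZero m := by
  have hn : ∀ n, ‖g n / (besselZero n : ℂ)‖ ^ 2 = besselZero n ^ (-2 : ℝ) * ‖g n‖ ^ 2 := by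
    intro n
    have hz := besselZero_pos n
    rw [norm_div, Complex.norm_real, Real.norm_eq_abs, abs_of_pos hz, div_pow,
      Real.rpow_neg hz.le]
    norm_cast
    field_simp
  have hc : Summable fun n => ‖g n / (besselZero n : ℂ)‖ ^ 2 := by
    refine Summable.of_nonneg_of_le (fun n => sq_nonneg _) (fun n => ?_) hg
    rw [hn]
    gcongr
    · exact (one_lt_besselZero n).le
    · linarith
  obtain ⟨h1, h2⟩ := inner_eigen_tsum hc
  refine ⟨⟨?_, ?_⟩, h2⟩
  · simp_rw [h2]
    exact h1
  · rw [memℓp_two_iff]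
    refine hg.congr fun n => ?_
    rw [norm_sq_coord, h2, hn, ← mul_assoc, ← Real.rpow_add (besselZero_pos n)]
    congr 2

theorem inner_eigen_randomSeries {s : ℝ} (hs : 0 ≤ s) {g : ℕ → ℂ}
    (hg : Summable fun n => besselZero n ^ (2 * s - 2) * ‖g n‖ ^ 2) (m : ℕ) :
    (inner ℂ (eigen m) (randomSeries s g).toL2 : ℂ) = g m / besselZero m := by
  obtain ⟨h1, h2⟩ := randomSeries_mem hs hg
  have e : randomSeries s g = ⟨_, h1⟩ := dif_pos h1
  rw [e]
  exact h2 m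

theorem ae_inner_eigen_randomSeries {s : ℝ} (hs : 0 ≤ s) (hs' : s < 1 / 2) :
    ∀ᵐ g ∂gaussianSequence, ∀ m,
      (inner ℂ (eigen m) (randomSeries s g).toL2 : ℂ) = g m / besselZero m := by
  filter_upwards [ae_summable_gaussianSequence
    (fun n => Real.rpow_nonneg (besselZero_pos n).le (2 * s - 2))
    -- The condition `s < 1/2` enters as `2s - 2 < -1`.
    (summable_besselZero_rpow (by linarith))] with g hg
  exact inner_eigen_randomSeries hs hg

/-- An almost sure limit of continuous partial sums. Without this, `Measure.map` would return its
default value `0`. -/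
theorem aemeasurable_randomSeries {s : ℝ} (hs : 0 ≤ s) (hs' : s < 1 / 2) :
    AEMeasurable (randomSeries s) gaussianSequence := by
  refine aemeasurable_of_tendsto_metrizable_ae atTop
    (f := fun N g => ∑ n ∈ Finset.range N, (g n / (besselZero n : ℂ)) • HsRad.eigen s n)
    (fun N => ?_) ?_
  · exact (by fun_prop : Continuous _).measurable.aemeasurable
  · filter_upwards [ae_inner_eigen_randomSeries hs hs'] with g hg
    have h := (randomSeries s g).tendsto_sum_eigen
    simp_rw [hg] at h
    exact h

theorem isProbabilityMeasure_freeMeasure {s : ℝ} (hs : 0 ≤ s) (hs' : s < 1 / 2) :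
    IsProbabilityMeasure (freeMeasure s) :=
  Measure.isProbabilityMeasure_map (aemeasurable_randomSeries hs hs')

/-! ### Integral functionals on `L²(Θ)` -/

/-- Fatou along a subsequence that converges almost everywhere. The form with `∃ᶠ` yields both lower
semicontinuity and closed sublevel sets. -/
theorem lintegral_comp_le_of_frequently {f : ℂ → ℝ≥0∞} (hf : Continuous f) {u : ℕ → L2Disc}
    {v : L2Disc} (hu : Tendsto u atTop (𝓝 v)) {a : ℝ≥0∞}
    (ha : ∃ᶠ n in atTop, ∫⁻ x, f (u n x) ∂discMeasure ≤ a) :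
    ∫⁻ x, f (v x) ∂discMeasure ≤ a := by
  obtain ⟨φ, hφ, hφa⟩ := extraction_of_frequently_atTop ha
  have h1 := tendstoInMeasure_of_tendsto_Lp (hu.comp hφ.tendsto_atTop)
  obtain ⟨ψ, hψ, hlim⟩ := h1.exists_seq_tendsto_ae
  calc ∫⁻ x, f (v x) ∂discMeasure
      = ∫⁻ x, liminf (fun n => f (u (φ (ψ n)) x)) atTop ∂discMeasure := by
        refine lintegral_congr_ae ?_
        filter_upwards [hlim] with x hx
        exact ((hf.tendsto _).comp hx).liminf_eq.symm
    _ ≤ liminf (fun n => ∫⁻ x, f (u (φ (ψ n)) x) ∂discMeasure) atTop :=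
        lintegral_liminf_le' fun n =>
          hf.measurable.comp_aemeasurable (Lp.aestronglyMeasurable _).aemeasurable
    _ ≤ a := liminf_le_of_le (by isBoundedDefault) fun b hb => by
        obtain ⟨n, hn⟩ := hb.exists
        exact hn.trans (hφa _)

theorem lintegral_comp_le_liminf {f : ℂ → ℝ≥0∞} (hf : Continuous f) {u : ℕ → L2Disc}
    {v : L2Disc} (hu : Tendsto u atTop (𝓝 v)) :
    ∫⁻ x, f (v x) ∂discMeasure ≤ liminf (fun n => ∫⁻ x, f (u n x) ∂discMeasure) atTop :=
  le_of_forall_gt_imp_ge_of_dense fun _ ha => lintegral_comp_le_of_frequently hf hu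
    ((frequently_lt_of_liminf_lt (by isBoundedDefault) ha).mono fun _ h => h.le)

/-- Closed sublevel sets give measurability without choosing representatives of `L²` classes jointly
measurable in the parameter and `x`. -/
theorem measurable_lintegral_comp {X : Type*} [TopologicalSpace X] [MeasurableSpace X]
    [OpensMeasurableSpace X] {T : X → L2Disc} (hT : Continuous T) {f : ℂ → ℝ≥0∞}
    (hf : Continuous f) : Measurable fun p => ∫⁻ x, f (T p x) ∂discMeasure := by
  refine measurable_of_Iic fun a => ?_
  have h : IsClosed {u : L2Disc | ∫⁻ x, f (u x) ∂discMeasure ≤ a} := by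
    refine IsSeqClosed.isClosed fun u v hu huv => ?_
    exact lintegral_comp_le_of_frequently hf huv (Eventually.of_forall hu).frequently
  exact (h.preimage hT).measurableSet

theorem continuous_proj (N : ℕ) : Continuous (proj N) := by
  unfold proj
  fun_prop

theorem proj_eq_sum_of_inner {u : L2Disc} {c : ℕ → ℂ}
    (h : ∀ n, (inner ℂ (eigen n) u : ℂ) = c n) (N : ℕ) :
    proj N u = ∑ n ∈ Finset.range N, c n • eigen n := by
  simp [proj, h]

theorem sum_smul_eigen_ae (c : ℕ → ℂ) (S : Finset ℕ) :
    ⇑(∑ n ∈ S, c n • eigen n) =ᵐ[discMeasure] fun x => ∑ n ∈ S, c n * (eigenReal n x : ℂ) := by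
  induction S using Finset.induction_on with
  | empty =>
    simp only [Finset.sum_empty]
    exact Lp.coeFn_zero ℂ 2 discMeasure
  | insert i S hi ih =>
    rw [Finset.sum_insert hi]
    filter_upwards [Lp.coeFn_add (c i • eigen i) (∑ n ∈ S, c n • eigen n), ih,
      Lp.coeFn_smul (c i) (eigen i), (memLp_eigenFun i).coeFn_toLp] with x h1 h2 h3 h4
    rw [h1, Pi.add_apply, h2, h3, Finset.sum_insert hi, Pi.smul_apply, eigen, h4, eigenFun_eq,
      smul_eq_mul]

theorem integrable_comp_proj {V : ℂ → ℝ} (hV : Continuous V) (N : ℕ) (u : L2Disc) :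
    Integrable (fun x => V (proj N u x)) discMeasure := by
  have hc : Continuous fun x : EuclideanSpace ℝ (Fin 2) =>
      V (∑ n ∈ Finset.range N, (inner ℂ (eigen n) u : ℂ) * (eigenReal n x : ℂ)) := by
    have := continuous_eigenReal
    fun_prop
  have hi : Integrable (fun x : EuclideanSpace ℝ (Fin 2) =>
      V (∑ n ∈ Finset.range N, (inner ℂ (eigen n) u : ℂ) * (eigenReal n x : ℂ))) discMeasure :=
    (hc.continuousOn.integrableOn_compact (isCompact_closedBall 0 1)).mono_set
      Metric.ball_subset_closedBall
  refine hi.congr ?_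
  filter_upwards [sum_smul_eigen_ae (fun n => (inner ℂ (eigen n) u : ℂ)) (Finset.range N)]
    with x hx
  rw [proj, hx]

/-! ### Sixth moments of the free field -/

/-- The tails of the series `∑ z_n^{-3/2}`. -/
def zeroTail (M : ℕ) : ℝ := ∑' n, besselZero (n + M) ^ (-(3 / 2) : ℝ)

theorem summable_besselZero_tail : Summable fun n => besselZero n ^ (-(3 / 2) : ℝ) :=
  summable_besselZero_rpow (by norm_num)

theorem zeroTail_pos (M : ℕ) : 0 < zeroTail M :=
  ((summable_nat_add_iff M).2 summable_besselZero_tail).tsum_pos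
    (fun _ => Real.rpow_nonneg (besselZero_pos _).le _) 0
    (Real.rpow_pos_of_pos (besselZero_pos _) _)

theorem tendsto_zeroTail : Tendsto zeroTail atTop (𝓝 0) :=
  tendsto_sum_nat_add fun n => besselZero n ^ (-(3 / 2) : ℝ)

theorem sum_Ico_le_zeroTail (M N : ℕ) :
    ∑ n ∈ Finset.Ico M N, besselZero n ^ (-(3 / 2) : ℝ) ≤ zeroTail M := by
  rw [Finset.sum_Ico_eq_sum_range]
  simp_rw [add_comm M]
  exact ((summable_nat_add_iff M).2 summable_besselZero_tail).sum_le_tsum _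
    fun n _ => Real.rpow_nonneg (besselZero_pos _).le _

theorem ae_discMeasure_ne_zero : ∀ᵐ x ∂discMeasure, x ≠ 0 := by
  rw [discMeasure]
  exact ae_restrict_of_ae (Measure.ae_ne volume 0)

theorem exists_lintegral_gaussian_sum_le : ∃ K : NNReal, ∀ M N : ℕ,
    ∫⁻ x, ∫⁻ g, ‖∑ n ∈ Finset.Ico M N, ((eigenReal n x / besselZero n : ℝ) : ℂ) * g n‖ₑ ^ 6
      ∂gaussianSequence ∂discMeasure ≤ K * ENNReal.ofReal (zeroTail M) ^ 3 := by
  obtain ⟨C, hC⟩ := exists_lintegral_sum_pow_six_le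
  obtain ⟨D, hD, hpt⟩ := exists_eigenReal_sq_le
  have hI := lintegral_discMeasure_norm_rpow_lt_top
  set I := ∫⁻ x, ENNReal.ofReal (‖x‖ ^ (-(3 / 2) : ℝ)) ∂discMeasure
  have hK : (C * ENNReal.ofReal D ^ 3 * I : ℝ≥0∞) ≠ ⊤ := by
    have := hI.ne
    finiteness
  refine ⟨(C * ENNReal.ofReal D ^ 3 * I : ℝ≥0∞).toNNReal, fun M N => ?_⟩
  rw [ENNReal.coe_toNNReal hK]
  have hbound : ∀ᵐ x ∂discMeasure,
      ∫⁻ g, ‖∑ n ∈ Finset.Ico M N, ((eigenReal n x / besselZero n : ℝ) : ℂ) * g n‖ₑ ^ 6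
        ∂gaussianSequence ≤ (C * ENNReal.ofReal D ^ 3 * ENNReal.ofReal (zeroTail M) ^ 3) *
          ENNReal.ofReal (‖x‖ ^ (-(3 / 2) : ℝ)) := by
    filter_upwards [ae_discMeasure_ne_zero] with x hx
    have hx0 : 0 < ‖x‖ := norm_pos_iff.2 hx
    refine (hC _ _).trans ?_
    have h1 : ∑ n ∈ Finset.Ico M N, (eigenReal n x / besselZero n) ^ 2 ≤
        D * ‖x‖ ^ (-(1 / 2) : ℝ) * zeroTail M := by
      refine (Finset.sum_le_sum fun n _ => hpt n x hx).trans ?_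
      rw [← Finset.mul_sum]
      gcongr
      exact sum_Ico_le_zeroTail M N
    calc (C : ℝ≥0∞) * ENNReal.ofReal (∑ n ∈ Finset.Ico M N, (eigenReal n x / besselZero n) ^ 2) ^ 3
        ≤ C * ENNReal.ofReal (D * ‖x‖ ^ (-(1 / 2) : ℝ) * zeroTail M) ^ 3 := by gcongr
      _ = _ := by
        rw [ENNReal.ofReal_mul (by positivity), ENNReal.ofReal_mul hD.le, mul_pow, mul_pow,
          ← ENNReal.ofReal_pow (by positivity) 3, ← ENNReal.ofReal_pow (by positivity) 3,
          ← ENNReal.ofReal_pow (zeroTail_pos M).le 3, ← Real.rpow_natCast (‖x‖ ^ _),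
          ← Real.rpow_mul hx0.le]
        norm_num
        ring
  refine (lintegral_mono_ae hbound).trans_eq ?_
  rw [lintegral_const_mul _ (by fun_prop)]
  ring

theorem exists_lintegral_proj_sub_le {s : ℝ} (hs : 0 ≤ s) (hs' : s < 1 / 2) :
    ∃ K : NNReal, ∀ M N : ℕ, M ≤ N →
      ∫⁻ u : HsRad s, ∫⁻ x, ‖(proj N u.toL2 - proj M u.toL2) x‖ₑ ^ 6 ∂discMeasure
        ∂freeMeasure s ≤ K * ENNReal.ofReal (zeroTail M) ^ 3 := by
  obtain ⟨K, hK⟩ := exists_lintegral_gaussian_sum_le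
  refine ⟨K, fun M N hMN => ?_⟩
  have hT : Continuous fun u : HsRad s => proj N u.toL2 - proj M u.toL2 :=
    ((continuous_proj N).comp (HsRad.continuous_toL2 hs)).sub
      ((continuous_proj M).comp (HsRad.continuous_toL2 hs))
  rw [freeMeasure, lintegral_map' (measurable_lintegral_comp hT
    (f := fun z => ‖z‖ₑ ^ 6) (by fun_prop)).aemeasurable (aemeasurable_randomSeries hs hs')]
  refine le_trans (le_of_eq ?_) (hK M N)
  symm
  -- Tonelli: the Gaussian estimate was made at fixed `x`, while the free measure integrates over
  -- the disc first.
  rw [lintegral_lintegral_swap]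
  · refine (lintegral_congr_ae ?_).symm
    filter_upwards [ae_inner_eigen_randomSeries hs hs'] with g hg
    refine lintegral_congr_ae ?_
    have h1 : proj N (randomSeries s g).toL2 - proj M (randomSeries s g).toL2 =
        ∑ n ∈ Finset.Ico M N, (g n / (besselZero n : ℂ)) • eigen n := by
      rw [proj_eq_sum_of_inner hg, proj_eq_sum_of_inner hg, Finset.sum_Ico_eq_sub _ hMN]
    rw [h1]
    filter_upwards [sum_smul_eigen_ae (fun n => g n / (besselZero n : ℂ)) (Finset.Ico M N)]
      with x hx
    rw [hx]
    congr 2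
    refine Finset.sum_congr rfl fun n _ => ?_
    push_cast
    ring
  · refine Measurable.aemeasurable ?_
    have h : ∀ n, Measurable (eigenReal n) := fun n => (continuous_eigenReal n).measurable
    unfold Function.uncurry
    fun_prop

/-- The block bound is uniform in `N`, so `N → ∞` by Fatou, once on the disc and once under the free
measure. -/
theorem exists_lintegral_sub_proj_le {s : ℝ} (hs : 0 ≤ s) (hs' : s < 1 / 2) :
    ∃ K : NNReal, ∀ M : ℕ,
      ∫⁻ u : HsRad s, ∫⁻ x, ‖(u.toL2 - proj M u.toL2) x‖ₑ ^ 6 ∂discMeasure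
        ∂freeMeasure s ≤ K * ENNReal.ofReal (zeroTail M) ^ 3 := by
  obtain ⟨K, hK⟩ := exists_lintegral_proj_sub_le hs hs'
  refine ⟨K, fun M => ?_⟩
  have hT : ∀ N, Continuous fun u : HsRad s => proj N u.toL2 - proj M u.toL2 := fun N =>
    ((continuous_proj N).comp (HsRad.continuous_toL2 hs)).sub
      ((continuous_proj M).comp (HsRad.continuous_toL2 hs))
  calc ∫⁻ u : HsRad s, ∫⁻ x, ‖(u.toL2 - proj M u.toL2) x‖ₑ ^ 6 ∂discMeasure ∂freeMeasure s
      ≤ ∫⁻ u : HsRad s, liminf (fun N => ∫⁻ x, ‖(proj N u.toL2 - proj M u.toL2) x‖ₑ ^ 6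
          ∂discMeasure) atTop ∂freeMeasure s := by
        refine lintegral_mono fun u => ?_
        exact lintegral_comp_le_liminf (f := fun z => ‖z‖ₑ ^ 6) (by fun_prop)
          (u.hasSum_eigen.tendsto_sum_nat.sub_const _)
    _ ≤ liminf (fun N => ∫⁻ u : HsRad s, ∫⁻ x, ‖(proj N u.toL2 - proj M u.toL2) x‖ₑ ^ 6
          ∂discMeasure ∂freeMeasure s) atTop :=
        lintegral_liminf_le fun N => measurable_lintegral_comp (hT N)
          (f := fun z => ‖z‖ₑ ^ 6) (by fun_prop)
    _ ≤ _ := liminf_le_of_le (by isBoundedDefault) fun b hb => by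
        obtain ⟨N, hN, hMN⟩ := (hb.and (eventually_ge_atTop M)).exists
        exact hN.trans (hK M N hMN)

/-! ### Growth of the potential -/

/-- The sum and difference of the two Wirtinger parts recover `L 1` and `I * L I`, and these
determine the real-linear map `L`. -/
theorem norm_clm_le_wirtinger (L : ℂ →L[ℝ] ℂ) {a b : ℝ}
    (ha : ‖(1 / 2 : ℂ) * (L 1 - Complex.I * L Complex.I)‖ ≤ a)
    (hb : ‖(1 / 2 : ℂ) * (L 1 + Complex.I * L Complex.I)‖ ≤ b) : ‖L‖ ≤ 2 * (a + b) := by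
  have ha0 : 0 ≤ a := (norm_nonneg _).trans ha
  have hb0 : 0 ≤ b := (norm_nonneg _).trans hb
  have h1 : ‖L 1‖ ≤ a + b := by
    have e : L 1 = (1 / 2 : ℂ) * (L 1 - Complex.I * L Complex.I) +
        (1 / 2 : ℂ) * (L 1 + Complex.I * L Complex.I) := by ring
    rw [e]
    exact (norm_add_le _ _).trans (add_le_add ha hb)
  have hI : ‖L Complex.I‖ ≤ a + b := by
    have e : Complex.I * L Complex.I = (1 / 2 : ℂ) * (L 1 + Complex.I * L Complex.I) -
        (1 / 2 : ℂ) * (L 1 - Complex.I * L Complex.I) := by ring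
    have e2 : ‖L Complex.I‖ = ‖Complex.I * L Complex.I‖ := by simp
    rw [e2, e, add_comm a b]
    exact (norm_sub_le _ _).trans (add_le_add hb ha)
  refine L.opNorm_le_bound (by positivity) fun z => ?_
  have e : L z = z.re • L 1 + z.im • L Complex.I := by
    rw [← map_smul, ← map_smul, ← map_add]
    congr 1
    simp [Complex.re_add_im]
  rw [e]
  calc _ ≤ ‖z.re • L 1‖ + ‖z.im • L Complex.I‖ := norm_add_le _ _
    _ ≤ ‖z‖ * (a + b) + ‖z‖ * (a + b) := by
      rw [norm_smul, norm_smul]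
      gcongr
      · exact Complex.abs_re_le_norm z
      · exact Complex.abs_im_le_norm z
    _ = _ := by ring

theorem one_add_norm_rpow_le {p : ℝ} {k : ℕ} (hp : p ≤ k) (z : ℂ) :
    (1 + ‖z‖) ^ p ≤ (1 + ‖z‖) ^ k := by
  rw [← Real.rpow_natCast]
  exact Real.rpow_le_rpow_of_exponent_le (by linarith [norm_nonneg z]) hp

theorem GrowthBound.exists_abs_le {V : ℂ → ℝ} {α : ℝ} (h : GrowthBound V α) (hα : α < 4) :
    ∃ C : ℝ, 0 < C ∧ ∀ z, |V z| ≤ C * (1 + ‖z‖) ^ 6 := by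
  obtain ⟨C, hC, hb⟩ := h 0 0
  refine ⟨C, hC, fun z => ?_⟩
  have h1 := hb z
  simp only [Function.iterate_zero, id, Complex.norm_real, Real.norm_eq_abs] at h1
  refine h1.trans (mul_le_mul_of_nonneg_left (one_add_norm_rpow_le ?_ z) hC.le)
  push_cast
  linarith

/-- Mean value inequality on the ball of radius `|a| + |b|`, which is convex and contains both
points; first derivatives grow with exponent `1 + α < 5`. -/
theorem GrowthBound.exists_abs_sub_le {V : ℂ → ℝ} {α : ℝ} (h : GrowthBound V α) (hα : α < 4)
    (hV : Differentiable ℝ V) : ∃ C : ℝ, 0 < C ∧ ∀ a b,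
      |V a - V b| ≤ C * (‖a - b‖ * (1 + ‖a‖ + ‖b‖) ^ 5) := by
  obtain ⟨C₁, hC₁, h₁⟩ := h 1 0
  obtain ⟨C₂, hC₂, h₂⟩ := h 0 1
  simp only [Function.iterate_zero, Function.iterate_one, id] at h₁ h₂
  refine ⟨2 * (C₁ + C₂), by positivity, fun a b => ?_⟩
  set W : ℂ → ℂ := fun w => (V w : ℂ) with hW
  have hWd : Differentiable ℝ W := Complex.ofRealCLM.differentiable.comp hV
  have hderiv : ∀ z ∈ Metric.closedBall (0 : ℂ) (‖a‖ + ‖b‖),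
      ‖fderiv ℝ W z‖ ≤ 2 * (C₁ + C₂) * (1 + ‖a‖ + ‖b‖) ^ 5 := by
    intro z hz
    have hz' : ‖z‖ ≤ ‖a‖ + ‖b‖ := by simpa using hz
    have k₁ := (h₁ z).trans (mul_le_mul_of_nonneg_left
      (one_add_norm_rpow_le (k := 5) (by push_cast; linarith) z) hC₁.le)
    have k₂ := (h₂ z).trans (mul_le_mul_of_nonneg_left
      (one_add_norm_rpow_le (k := 5) (by push_cast; linarith) z) hC₂.le)
    refine (norm_clm_le_wirtinger _ k₁ k₂).trans ?_
    calc _ = 2 * (C₁ + C₂) * (1 + ‖z‖) ^ 5 := by ring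
      _ ≤ _ := by
        rw [add_assoc]
        gcongr
  have h3 := (convex_closedBall (0 : ℂ) (‖a‖ + ‖b‖)).norm_image_sub_le_of_norm_fderiv_le
    (𝕜 := ℝ) (f := W) (fun z _ => hWd z) hderiv (x := b) (y := a) (by simp) (by simp)
  have e : |V a - V b| = ‖W a - W b‖ := by
    rw [hW, ← Complex.ofReal_sub, Complex.norm_real, Real.norm_eq_abs]
  rw [e]
  refine h3.trans_eq ?_
  ring

/-- Weighted Young, by cases on whether `x ≤ δ y`. The small weight falls on the bounded sixth
moment, the large one on the error. -/
theorem mul_pow_five_le {x y δ : ℝ} (hx : 0 ≤ x) (hy : 0 ≤ y) (hδ : 0 < δ) :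
    x * y ^ 5 ≤ δ * y ^ 6 + x ^ 6 / δ ^ 5 := by
  rcases le_total x (δ * y) with h | h
  · calc x * y ^ 5 ≤ δ * y * y ^ 5 := by gcongr
      _ = δ * y ^ 6 := by ring
      _ ≤ _ := le_add_of_nonneg_right (by positivity)
  · have h1 : x * y ^ 5 ≤ x ^ 6 / δ ^ 5 := by
      rw [le_div_iff₀ (by positivity)]
      calc x * y ^ 5 * δ ^ 5 = x * (δ * y) ^ 5 := by ring
        _ ≤ x * x ^ 5 := by gcongr
        _ = x ^ 6 := by ring
    exact h1.trans (le_add_of_nonneg_left (by positivity))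

theorem one_add_add_pow_six_le {x y : ℝ} (hx : 0 ≤ x) (hy : 0 ≤ y) :
    (1 + x + y) ^ 6 ≤ 1024 * (1 + x ^ 6 + y ^ 6) := by
  have h1 := add_pow_le (add_nonneg zero_le_one hx) hy 6
  have h2 := add_pow_le (zero_le_one (α := ℝ)) hx 6
  have h3 : 0 ≤ y ^ 6 := by positivity
  norm_num at h1 h2
  linarith

theorem enorm_sub_le_of_growth {V : ℂ → ℝ} {C : ℝ} (hC : 0 < C)
    (h : ∀ a b, |V a - V b| ≤ C * (‖a - b‖ * (1 + ‖a‖ + ‖b‖) ^ 5)) {δ : ℝ} (hδ : 0 < δ) (a b : ℂ) :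
    ‖V a - V b‖ₑ ≤ ENNReal.ofReal (C * δ * 1024) * (1 + ‖a‖ₑ ^ 6 + ‖b‖ₑ ^ 6) +
      ENNReal.ofReal (C / δ ^ 5) * ‖b - a‖ₑ ^ 6 := by
  have h1 : ‖V a - V b‖ ≤ C * δ * 1024 * (1 + ‖a‖ ^ 6 + ‖b‖ ^ 6) + C / δ ^ 5 * ‖b - a‖ ^ 6 := by
    calc ‖V a - V b‖ ≤ C * (‖a - b‖ * (1 + ‖a‖ + ‖b‖) ^ 5) := h a b
      _ ≤ C * (δ * (1 + ‖a‖ + ‖b‖) ^ 6 + ‖a - b‖ ^ 6 / δ ^ 5) := by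
        gcongr
        exact mul_pow_five_le (norm_nonneg _) (by positivity) hδ
      _ ≤ C * (δ * (1024 * (1 + ‖a‖ ^ 6 + ‖b‖ ^ 6)) + ‖a - b‖ ^ 6 / δ ^ 5) := by
        gcongr
        exact one_add_add_pow_six_le (norm_nonneg _) (norm_nonneg _)
      _ = _ := by
        rw [norm_sub_rev a b]
        ring
  have h2 := ENNReal.ofReal_le_ofReal h1
  rw [ENNReal.ofReal_add (by positivity) (by positivity),
    ENNReal.ofReal_mul (by positivity : 0 ≤ C * δ * 1024),
    ENNReal.ofReal_mul (by positivity : 0 ≤ C / δ ^ 5),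
    ENNReal.ofReal_add (by positivity) (by positivity),
    ENNReal.ofReal_add (by positivity) (by positivity), ENNReal.ofReal_pow (norm_nonneg _),
    ENNReal.ofReal_pow (norm_nonneg _), ENNReal.ofReal_pow (norm_nonneg _)] at h2
  simpa only [ofReal_norm, ENNReal.ofReal_one] using h2

theorem enorm_le_of_growth {V : ℂ → ℝ} {C : ℝ} (hC : 0 < C)
    (h : ∀ z, |V z| ≤ C * (1 + ‖z‖) ^ 6) (z : ℂ) :
    ‖V z‖ₑ ≤ ENNReal.ofReal (C * 1024) * (1 + ‖z‖ₑ ^ 6) := by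
  have h1 : ‖V z‖ ≤ C * 1024 * (1 + ‖z‖ ^ 6) := by
    refine (h z).trans ?_
    have := one_add_add_pow_six_le (norm_nonneg z) le_rfl
    norm_num at this
    nlinarith
  have h2 := ENNReal.ofReal_le_ofReal h1
  rw [ENNReal.ofReal_mul (by positivity), ENNReal.ofReal_add (by positivity) (by positivity),
    ENNReal.ofReal_pow (norm_nonneg _)] at h2
  simpa only [ofReal_norm, ENNReal.ofReal_one] using h2

/-! ### Integrability of the potential -/

theorem lintegral_comp_le_of_growth {V : ℂ → ℝ} {C : ℝ} (hC : 0 < C)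
    (h : ∀ z, |V z| ≤ C * (1 + ‖z‖) ^ 6) (u : L2Disc) :
    ∫⁻ x, ‖V (u x)‖ₑ ∂discMeasure ≤ ENNReal.ofReal (C * 1024) *
      (discMeasure Set.univ + ∫⁻ x, ‖u x‖ₑ ^ 6 ∂discMeasure) := by
  refine (lintegral_mono fun x => enorm_le_of_growth hC h (u x)).trans_eq ?_
  rw [lintegral_const_mul' _ _ (by simp), lintegral_add_left measurable_const, lintegral_const,
    one_mul]

theorem integrable_comp_of_growth {V : ℂ → ℝ} (hV : Continuous V) {C : ℝ} (hC : 0 < C)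
    (h : ∀ z, |V z| ≤ C * (1 + ‖z‖) ^ 6) {u : L2Disc}
    (hu : ∫⁻ x, ‖u x‖ₑ ^ 6 ∂discMeasure < ⊤) :
    Integrable (fun x => V (u x)) discMeasure := by
  refine ⟨hV.comp_aestronglyMeasurable (Lp.aestronglyMeasurable u), ?_⟩
  refine (lintegral_comp_le_of_growth hC h u).trans_lt ?_
  have := measure_lt_top discMeasure Set.univ
  exact ENNReal.mul_lt_top (by simp) (ENNReal.add_lt_top.2 ⟨this, hu⟩)

section Potential

variable {X : Type*} [TopologicalSpace X] [MeasurableSpace X] [OpensMeasurableSpace X]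
  {μ : Measure X} {T : X → L2Disc} {V : ℂ → ℝ}

/-- Almost everywhere the potential is the difference of the integrals of the positive and negative
parts of `V`, each measurable by lower semicontinuity. -/
theorem aestronglyMeasurable_potential (hT : Continuous T) (hV : Continuous V)
    (hint : ∀ᵐ u ∂μ, Integrable (fun x => V (T u x)) discMeasure) :
    AEStronglyMeasurable (fun u => potential V (T u)) μ := by
  have h1 := measurable_lintegral_comp hT (f := fun z => ENNReal.ofReal (V z))
    (ENNReal.continuous_ofReal.comp hV)
  have h2 := measurable_lintegral_comp hT (f := fun z => ENNReal.ofReal (-V z))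
    (ENNReal.continuous_ofReal.comp hV.neg)
  refine (h1.ennreal_toReal.sub h2.ennreal_toReal).aestronglyMeasurable.congr ?_
  filter_upwards [hint] with u hu
  exact (integral_eq_lintegral_pos_part_sub_lintegral_neg_part hu).symm

theorem ae_integrable_comp (hT : Continuous T) (hV : Continuous V) {C : ℝ} (hC : 0 < C)
    (h : ∀ z, |V z| ≤ C * (1 + ‖z‖) ^ 6)
    (h6 : ∫⁻ u, ∫⁻ x, ‖T u x‖ₑ ^ 6 ∂discMeasure ∂μ < ⊤) :
    ∀ᵐ u ∂μ, Integrable (fun x => V (T u x)) discMeasure := by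
  filter_upwards [ae_lt_top (measurable_lintegral_comp hT (f := fun z => ‖z‖ₑ ^ 6)
    (by fun_prop)) h6.ne] with u hu
  exact integrable_comp_of_growth hV hC h hu

theorem integrable_potential [IsFiniteMeasure μ] (hT : Continuous T) (hV : Continuous V) {C : ℝ}
    (hC : 0 < C) (h : ∀ z, |V z| ≤ C * (1 + ‖z‖) ^ 6)
    (h6 : ∫⁻ u, ∫⁻ x, ‖T u x‖ₑ ^ 6 ∂discMeasure ∂μ < ⊤) :
    Integrable (fun u => potential V (T u)) μ := by
  refine ⟨aestronglyMeasurable_potential hT hV (ae_integrable_comp hT hV hC h h6), ?_⟩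
  calc ∫⁻ u, ‖potential V (T u)‖ₑ ∂μ
      ≤ ∫⁻ u, ENNReal.ofReal (C * 1024) *
        (discMeasure Set.univ + ∫⁻ x, ‖T u x‖ₑ ^ 6 ∂discMeasure) ∂μ :=
        lintegral_mono fun u => (enorm_integral_le_lintegral_enorm _).trans
          (lintegral_comp_le_of_growth hC h (T u))
    _ = ENNReal.ofReal (C * 1024) * (discMeasure Set.univ * μ Set.univ +
        ∫⁻ u, ∫⁻ x, ‖T u x‖ₑ ^ 6 ∂discMeasure ∂μ) := by
        rw [lintegral_const_mul' _ _ (by simp), lintegral_add_left measurable_const,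
          lintegral_const]
    _ < ⊤ := ENNReal.mul_lt_top (by simp) (ENNReal.add_lt_top.2
        ⟨ENNReal.mul_lt_top (measure_lt_top _ _) (measure_lt_top _ _), h6⟩)

end Potential

/-! ### Sixth-moment bounds and convergence of the truncated potentials -/

theorem lintegral_pow_six_lt_top {s : ℝ} (hs : 0 ≤ s) (hs' : s < 1 / 2) :
    ∫⁻ u : HsRad s, ∫⁻ x, ‖u.toL2 x‖ₑ ^ 6 ∂discMeasure ∂freeMeasure s < ⊤ := by
  obtain ⟨K, hK⟩ := exists_lintegral_sub_proj_le hs hs'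
  have h := hK 0
  simp only [proj, Finset.range_zero, Finset.sum_empty, sub_zero] at h
  exact h.trans_lt (by finiteness)

theorem exists_lintegral_proj_pow_six_le {s : ℝ} (hs : 0 ≤ s) (hs' : s < 1 / 2) :
    ∃ B : NNReal, ∀ N, ∫⁻ u : HsRad s, ∫⁻ x, ‖proj N u.toL2 x‖ₑ ^ 6 ∂discMeasure
      ∂freeMeasure s ≤ B := by
  obtain ⟨K, hK⟩ := exists_lintegral_proj_sub_le hs hs'
  refine ⟨(K * ENNReal.ofReal (zeroTail 0) ^ 3 : ℝ≥0∞).toNNReal, fun N => ?_⟩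
  rw [ENNReal.coe_toNNReal (by finiteness)]
  have h := hK 0 N (Nat.zero_le _)
  have e : ∀ u : L2Disc, proj 0 u = 0 := fun u => by simp [proj]
  simp only [e, sub_zero] at h
  exact h

theorem lintegral_const_mul_add_add {X : Type*} [MeasurableSpace X] {μ : Measure X}
    {f g : X → ℝ≥0∞} (hf : AEMeasurable f μ) (hg : AEMeasurable g μ) (h : X → ℝ≥0∞)
    {c k : ℝ≥0∞} (hc : c ≠ ⊤) (hk : k ≠ ⊤) (d : ℝ≥0∞) :
    ∫⁻ x, c * (d + f x + g x) + k * h x ∂μ =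
      c * (d * μ Set.univ + ∫⁻ x, f x ∂μ + ∫⁻ x, g x ∂μ) + k * ∫⁻ x, h x ∂μ := by
  have h1 : AEMeasurable (fun x => d + f x) μ := hf.const_add d
  have h2 : AEMeasurable (fun x => c * (d + f x + g x)) μ := (h1.add hg).const_mul c
  rw [lintegral_add_left' h2, lintegral_const_mul' _ _ hc, lintegral_const_mul' _ _ hk,
    lintegral_add_left' h1, lintegral_add_left' aemeasurable_const, lintegral_const]

theorem tendsto_eLpNorm_potential_sub {s : ℝ} (hs : 0 ≤ s) (hs' : s < 1 / 2) {V : ℂ → ℝ}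
    (hV : Continuous V) {C₀ : ℝ} (hC₀ : 0 < C₀) (h₀ : ∀ z, |V z| ≤ C₀ * (1 + ‖z‖) ^ 6)
    {C : ℝ} (hC : 0 < C) (h : ∀ a b, |V a - V b| ≤ C * (‖a - b‖ * (1 + ‖a‖ + ‖b‖) ^ 5)) :
    Tendsto (fun N : ℕ => eLpNorm
      (fun u : HsRad s => potential V (proj N u.toL2) - potential V u.toL2) 1 (freeMeasure s))
      atTop (𝓝 0) := by
  have := isProbabilityMeasure_freeMeasure hs hs'
  obtain ⟨K, hK⟩ := exists_lintegral_sub_proj_le hs hs'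
  obtain ⟨B, hB⟩ := exists_lintegral_proj_pow_six_le hs hs'
  have hT := HsRad.continuous_toL2 hs
  have h6 := lintegral_pow_six_lt_top hs hs'
  set I := ∫⁻ u : HsRad s, ∫⁻ x, ‖u.toL2 x‖ₑ ^ 6 ∂discMeasure ∂freeMeasure s with hI
  set A : ℝ≥0∞ := discMeasure Set.univ + B + I with hA
  have hAtop : A ≠ ⊤ := by
    have := h6.ne
    rw [hA]
    finiteness
  -- With `δ² = τ` the error weight is `τ³ / δ⁵ = δ`, so both Young terms have the same order
  -- `√τ_N`.
  set δ : ℕ → ℝ := fun N => Real.sqrt (zeroTail N) with hδ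
  have hδ0 : ∀ N, 0 < δ N := fun N => Real.sqrt_pos.2 (zeroTail_pos N)
  have hbound : ∀ N, eLpNorm
      (fun u : HsRad s => potential V (proj N u.toL2) - potential V u.toL2) 1 (freeMeasure s) ≤
      ENNReal.ofReal (δ N) * (ENNReal.ofReal (C * 1024) * A + ENNReal.ofReal C * K) := by
    intro N
    rw [eLpNorm_one_eq_lintegral_enorm]
    have hTN := (continuous_proj N).comp hT
    have hm1 : Measurable fun u : HsRad s => ∫⁻ x, ‖proj N u.toL2 x‖ₑ ^ 6 ∂discMeasure :=
      measurable_lintegral_comp hTN (f := fun z => ‖z‖ₑ ^ 6) (by fun_prop)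
    have hm2 := measurable_lintegral_comp hT (f := fun z => ‖z‖ₑ ^ 6) (by fun_prop)
    have hpt : ∀ᵐ u : HsRad s ∂freeMeasure s,
        ‖potential V (proj N u.toL2) - potential V u.toL2‖ₑ ≤
        ENNReal.ofReal (C * δ N * 1024) * (discMeasure Set.univ +
          ∫⁻ x, ‖proj N u.toL2 x‖ₑ ^ 6 ∂discMeasure + ∫⁻ x, ‖u.toL2 x‖ₑ ^ 6 ∂discMeasure) +
        ENNReal.ofReal (C / δ N ^ 5) *
          ∫⁻ x, ‖(u.toL2 - proj N u.toL2) x‖ₑ ^ 6 ∂discMeasure := by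
      filter_upwards [ae_integrable_comp hT hV hC₀ h₀ h6] with u hu
      rw [potential, potential, ← integral_sub (integrable_comp_proj hV N u.toL2) hu]
      refine (enorm_integral_le_lintegral_enorm _).trans ?_
      have hx1 : AEMeasurable (fun x => ‖proj N u.toL2 x‖ₑ ^ 6) discMeasure :=
        (Lp.aestronglyMeasurable (proj N u.toL2)).enorm.pow_const 6
      have hx2 : AEMeasurable (fun x => ‖u.toL2 x‖ₑ ^ 6) discMeasure :=
        (Lp.aestronglyMeasurable u.toL2).enorm.pow_const 6
      calc _ ≤ ∫⁻ x, ENNReal.ofReal (C * δ N * 1024) *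
              (1 + ‖proj N u.toL2 x‖ₑ ^ 6 + ‖u.toL2 x‖ₑ ^ 6) +
            ENNReal.ofReal (C / δ N ^ 5) * ‖(u.toL2 - proj N u.toL2) x‖ₑ ^ 6 ∂discMeasure := by
            refine lintegral_mono_ae ?_
            filter_upwards [Lp.coeFn_sub u.toL2 (proj N u.toL2)] with x hx
            rw [hx]
            exact enorm_sub_le_of_growth hC h (hδ0 N) _ _
        _ = _ := by
            rw [lintegral_const_mul_add_add hx1 hx2 _ (by simp) (by simp), one_mul]
    refine (lintegral_mono_ae hpt).trans ?_
    rw [lintegral_const_mul_add_add hm1.aemeasurable hm2.aemeasurable _ (by simp) (by simp),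
      measure_univ (μ := freeMeasure s), mul_one]
    have e1 : ENNReal.ofReal (C * δ N * 1024) =
        ENNReal.ofReal (δ N) * ENNReal.ofReal (C * 1024) := by
      rw [← ENNReal.ofReal_mul (hδ0 N).le]
      congr 1
      ring
    have e2 : ENNReal.ofReal (C / δ N ^ 5) * (K * ENNReal.ofReal (zeroTail N) ^ 3) =
        ENNReal.ofReal (δ N) * (ENNReal.ofReal C * K) := by
      have hz : zeroTail N = δ N ^ 2 := (Real.sq_sqrt (zeroTail_pos N).le).symm
      rw [mul_left_comm, ← ENNReal.ofReal_pow (zeroTail_pos N).le, hz,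
        ← ENNReal.ofReal_mul (by have := hδ0 N; positivity), mul_comm (ENNReal.ofReal C),
        mul_left_comm (ENNReal.ofReal (δ N)), ← ENNReal.ofReal_mul (hδ0 N).le]
      congr 2
      have := hδ0 N
      field_simp
    calc _ ≤ ENNReal.ofReal (C * δ N * 1024) * A +
          ENNReal.ofReal (C / δ N ^ 5) * (K * ENNReal.ofReal (zeroTail N) ^ 3) := by
          gcongr
          · rw [hA]
            gcongr
            exact hB N
          · exact hK N
      _ = _ := by
          rw [e1, e2]
          ring
  refine tendsto_of_tendsto_of_tendsto_of_le_of_le tendsto_const_nhds ?_ (fun _ => zero_le) hbound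
  have hδlim : Tendsto δ atTop (𝓝 0) := by simpa using tendsto_zeroTail.sqrt
  have h1 := ENNReal.Tendsto.mul_const (ENNReal.tendsto_ofReal hδlim)
    (b := ENNReal.ofReal (C * 1024) * A + ENNReal.ofReal C * K) (Or.inr (by finiteness))
  simpa using h1

/-! ### Small balls and nontriviality of the Gibbs measure -/

instance : complexGaussian.IsOpenPosMeasure := by
  have : (gaussianReal 0 1).IsOpenPosMeasure :=
    (gaussianReal_absolutelyContinuous' 0 one_ne_zero).isOpenPosMeasure
  unfold complexGaussian
  refine Continuous.isOpenPosMeasure_map (by fun_prop) fun z => ?_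
  refine ⟨(Real.sqrt 2 * z.re, Real.sqrt 2 * z.im), ?_⟩
  have h : ((Real.sqrt 2 : ℝ) : ℂ) ≠ 0 := by simp
  push_cast
  field_simp
  rw [mul_comm Complex.I, Complex.re_add_im]

/-- A coordinate with index at least `N` is independent of a box in the first `N` coordinates, so
restriction to the box only scales its law. -/
theorem setLIntegral_pi_enorm_sq {t : ℕ → Set ℂ} (ht : ∀ n, MeasurableSet (t n)) {N n : ℕ}
    (hn : N ≤ n) :
    ∫⁻ g in Set.pi (Finset.range N) t, ‖g n‖ₑ ^ 2 ∂gaussianSequence =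
      gaussianSequence (Set.pi (Finset.range N) t) * gaussianSecond := by
  classical
  have hnot : n ∉ Finset.range N := by simpa using hn
  have h : (gaussianSequence.restrict (Set.pi (Finset.range N) t)).map (fun g => g n) =
      gaussianSequence (Set.pi (Finset.range N) t) • complexGaussian := by
    ext S hS
    rw [Measure.map_apply (measurable_pi_apply n) hS,
      Measure.restrict_apply (measurable_pi_apply n hS), Measure.smul_apply, smul_eq_mul]
    have e : (fun g : ℕ → ℂ => g n) ⁻¹' S ∩ Set.pi (Finset.range N) t =
        Set.pi (insert n (Finset.range N) : Finset ℕ) (Function.update t n S) := by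
      ext g
      simp only [Set.mem_inter_iff, Set.mem_preimage, Set.mem_pi, Finset.mem_coe,
        Finset.mem_insert, forall_eq_or_imp, Function.update_self]
      refine and_congr_right fun _ => forall₂_congr fun i hi => ?_
      rw [Function.update_of_ne (ne_of_mem_of_not_mem hi hnot)]
    rw [e, gaussianSequence, Measure.infinitePi_pi, Measure.infinitePi_pi,
      Finset.prod_insert hnot, Function.update_self, mul_comm]
    · congr 1
      refine Finset.prod_congr rfl fun i hi => ?_
      rw [Function.update_of_ne (ne_of_mem_of_not_mem hi hnot)]
    · exact fun i _ => ht i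
    · intro i _
      by_cases h : i = n
      · subst h
        simpa using hS
      · simpa [Function.update_of_ne h] using ht i
  have h2 := lintegral_map (μ := gaussianSequence.restrict (Set.pi (Finset.range N) t))
    (f := fun z : ℂ => ‖z‖ₑ ^ 2) (by fun_prop) (measurable_pi_apply n)
  rw [h, lintegral_smul_measure, smul_eq_mul] at h2
  exact h2.symm

/-- The box has positive probability. If the tail were almost surely at least `η` on it, its
conditional mean would be too; by independence that mean is below `η`. -/
theorem measure_head_inter_tail_ne_zero {t : ℕ → Set ℂ} (ht : ∀ n, IsOpen (t n)) {N : ℕ}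
    (hne : ∀ n < N, (t n).Nonempty) {w : ℕ → ℝ≥0∞} {η : ℝ≥0∞}
    (hη : (∑' n, w (n + N)) * gaussianSecond < η) :
    gaussianSequence (Set.pi (Finset.range N) t ∩
      {g | ∑' n, w (n + N) * ‖g (n + N)‖ₑ ^ 2 < η}) ≠ 0 := by
  set A := Set.pi (Finset.range N : Set ℕ) t with hA
  have hmA : MeasurableSet A :=
    MeasurableSet.pi (Finset.countable_toSet _) fun n _ => (ht n).measurableSet
  have hA0 : gaussianSequence A ≠ 0 := by
    rw [hA, gaussianSequence, Measure.infinitePi_pi _ fun n _ => (ht n).measurableSet,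
      Finset.prod_ne_zero_iff]
    intro n hn
    exact ((ht n).measure_pos _ (hne n (Finset.mem_range.1 hn))).ne'
  have hm : ∀ n, Measurable fun g : ℕ → ℂ => w (n + N) * ‖g (n + N)‖ₑ ^ 2 := fun n =>
    Measurable.const_mul (by fun_prop) _
  intro h0
  have hae : ∀ᵐ g ∂gaussianSequence.restrict A, η ≤ ∑' n, w (n + N) * ‖g (n + N)‖ₑ ^ 2 := by
    rw [ae_restrict_iff' hmA, ae_iff]
    convert h0 using 2
    ext g
    simp
  have h1 : η * gaussianSequence A ≤
      ∫⁻ g in A, ∑' n, w (n + N) * ‖g (n + N)‖ₑ ^ 2 ∂gaussianSequence := by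
    rw [← setLIntegral_const]
    exact lintegral_mono_ae hae
  rw [lintegral_tsum fun n => (hm n).aemeasurable] at h1
  have h2 : ∀ n, ∫⁻ g in A, w (n + N) * ‖g (n + N)‖ₑ ^ 2 ∂gaussianSequence =
      w (n + N) * (gaussianSequence A * gaussianSecond) := fun n => by
    rw [lintegral_const_mul _ (by fun_prop),
      setLIntegral_pi_enorm_sq (fun n => (ht n).measurableSet) (Nat.le_add_left N n)]
  simp_rw [h2] at h1
  rw [ENNReal.tsum_mul_right, mul_left_comm, mul_comm η,
    ENNReal.mul_le_mul_iff_right hA0 (measure_ne_top _ _)] at h1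
  exact absurd h1 (not_le.2 hη)

theorem freeMeasure_annulus_ne_zero {s : ℝ} (hs : 0 ≤ s) (hs' : s < 1 / 2) {a b : ℝ}
    (ha : 0 ≤ a) (hab : a < b) :
    freeMeasure s {u : HsRad s | a < ‖u.toL2‖ ∧ ‖u.toL2‖ < b} ≠ 0 := by
  have hT := HsRad.continuous_toL2 hs
  have hopen : IsOpen {u : HsRad s | a < ‖u.toL2‖ ∧ ‖u.toL2‖ < b} :=
    (isOpen_lt continuous_const hT.norm).inter (isOpen_lt hT.norm continuous_const)
  rw [freeMeasure, Measure.map_apply_of_aemeasurable (aemeasurable_randomSeries hs hs')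
    hopen.measurableSet]
  -- Three shares of the gap: the first mode has squared norm in `(a², a² + η)`, the next `K` modes
  -- contribute at most `η` together, and the remaining tail less than `η`.
  set η : ℝ := (b ^ 2 - a ^ 2) / 3 with hη
  have hη0 : 0 < η := by
    have : a ^ 2 < b ^ 2 := pow_lt_pow_left₀ hab ha two_ne_zero
    rw [hη]
    linarith
  set w : ℕ → ℝ≥0∞ := fun n => ENNReal.ofReal (besselZero n ^ (-2 : ℝ)) with hw
  have hwsum : ∑' n, w n ≠ ⊤ := (summable_besselZero_rpow (by norm_num)).tsum_ofReal_ne_top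
  obtain ⟨K, hK⟩ : ∃ K : ℕ, (∑' n, w (n + (K + 1))) * gaussianSecond < ENNReal.ofReal η := by
    have h1 := ENNReal.Tendsto.mul_const (ENNReal.tendsto_sum_nat_add w hwsum)
      (b := gaussianSecond) (Or.inr gaussianSecond_lt_top.ne)
    rw [zero_mul] at h1
    exact ((h1.comp (tendsto_add_atTop_nat 1)).eventually_lt_const
      (ENNReal.ofReal_pos.2 hη0)).exists
  set t : ℕ → Set ℂ := fun n => if n = 0 then
    {z | a ^ 2 < ‖z / (besselZero 0 : ℂ)‖ ^ 2 ∧ ‖z / (besselZero 0 : ℂ)‖ ^ 2 < a ^ 2 + η} else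
    {z | ‖z / (besselZero n : ℂ)‖ ^ 2 < η / (K + 1)} with ht
  have htopen : ∀ n, IsOpen (t n) := by
    intro n
    simp only [ht]
    have hc : ∀ m, Continuous fun z : ℂ => ‖z / (besselZero m : ℂ)‖ ^ 2 := fun m => by fun_prop
    split_ifs
    · exact (isOpen_lt continuous_const (hc 0)).inter (isOpen_lt (hc 0) continuous_const)
    · exact isOpen_lt (hc n) continuous_const
  have htne : ∀ n < K + 1, (t n).Nonempty := by
    intro n _
    simp only [ht]
    split_ifs
    · have hz : (besselZero 0 : ℂ) ≠ 0 := by exact_mod_cast (besselZero_pos 0).ne'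
      refine ⟨besselZero 0 * (Real.sqrt (a ^ 2 + η / 2) : ℝ), ?_⟩
      rw [Set.mem_ofPred_eq, mul_div_cancel_left₀ _ hz, Complex.norm_real, Real.norm_eq_abs, sq_abs,
        Real.sq_sqrt (by positivity)]
      constructor <;> linarith
    · refine ⟨0, ?_⟩
      rw [Set.mem_ofPred_eq, zero_div, norm_zero, zero_pow two_ne_zero]
      positivity
  intro h0
  refine measure_head_inter_tail_ne_zero htopen htne hK (measure_mono_null_ae ?_ h0)
  filter_upwards [ae_inner_eigen_randomSeries hs hs'] with g hg hgA
  obtain ⟨hhead, htail⟩ := hgA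
  have hsum := (randomSeries s g).hasSum_norm_sq
  simp_rw [hg] at hsum
  have hw' : ∀ n, w n * ‖g n‖ₑ ^ 2 = ENNReal.ofReal (‖g n / (besselZero n : ℂ)‖ ^ 2) := by
    intro n
    have hz := besselZero_pos n
    rw [hw, ← ofReal_norm, ← ENNReal.ofReal_pow (norm_nonneg _),
      ← ENNReal.ofReal_mul (Real.rpow_nonneg hz.le _), norm_div, Complex.norm_real,
      Real.norm_eq_abs, abs_of_pos hz, div_pow, Real.rpow_neg hz.le]
    congr 1
    norm_cast
    field_simp
  have hsum' := (summable_nat_add_iff (K + 1)).2 hsum.summable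
  rw [Set.mem_ofPred_eq] at htail
  simp_rw [hw'] at htail
  rw [← ENNReal.ofReal_tsum_of_nonneg (fun n => sq_nonneg _) hsum',
    ENNReal.ofReal_lt_ofReal_iff hη0] at htail
  have htot := hsum.summable.sum_add_tsum_nat_add (K + 1)
  rw [hsum.tsum_eq, Finset.sum_range_succ'] at htot
  have h1 : a ^ 2 < ‖g 0 / (besselZero 0 : ℂ)‖ ^ 2 ∧
      ‖g 0 / (besselZero 0 : ℂ)‖ ^ 2 < a ^ 2 + η := by
    have := hhead 0 (by simp)
    simpa [ht] using this
  have h2 : ∑ n ∈ Finset.range K, ‖g (n + 1) / (besselZero (n + 1) : ℂ)‖ ^ 2 ≤ η := by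
    have h3 : ∀ n ∈ Finset.range K,
        ‖g (n + 1) / (besselZero (n + 1) : ℂ)‖ ^ 2 ≤ η / (K + 1) := by
      intro n hn
      have := hhead (n + 1) (by simpa using Finset.mem_range.1 hn)
      simp only [ht, Nat.add_eq_zero_iff, one_ne_zero, and_false, if_false,
        Set.mem_ofPred_eq] at this
      exact this.le
    refine (Finset.sum_le_sum h3).trans ?_
    rw [Finset.sum_const, Finset.card_range, nsmul_eq_mul, ← mul_div_assoc,
      div_le_iff₀ (by positivity)]
    nlinarith
  have h3 : 0 ≤ ∑ n ∈ Finset.range K, ‖g (n + 1) / (besselZero (n + 1) : ℂ)‖ ^ 2 :=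
    Finset.sum_nonneg fun n _ => sq_nonneg _
  have h4 : 0 ≤ ∑' n, ‖g (n + (K + 1)) / (besselZero (n + (K + 1)) : ℂ)‖ ^ 2 :=
    tsum_nonneg fun n => sq_nonneg _
  have hb2 : b ^ 2 = a ^ 2 + 3 * η := by
    rw [hη]
    ring
  refine ⟨lt_of_pow_lt_pow_left₀ 2 (norm_nonneg _) ?_,
    lt_of_pow_lt_pow_left₀ 2 (by linarith) ?_⟩
  · linarith [h1.1]
  · linarith [h1.2]

theorem gibbsMeasure_ne_zero {s : ℝ} (hs : 0 ≤ s) (hs' : s < 1 / 2) {V : ℂ → ℝ}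
    (hint : ∀ᵐ u : HsRad s ∂freeMeasure s, Integrable (fun x => V (u.toL2 x)) discMeasure)
    (hmeas : AEStronglyMeasurable (fun u : HsRad s => potential V u.toL2) (freeMeasure s))
    {χ : ℝ → ℝ} (hχ : Continuous χ) (hχ0 : ∀ x, 0 ≤ χ x) (hχne : ∃ x, 0 ≤ x ∧ χ x ≠ 0) :
    gibbsMeasure s V χ ≠ 0 := by
  classical
  intro h0
  obtain ⟨x₀, hx₀, hne⟩ := hχne
  obtain ⟨ε, hε, hball⟩ := Metric.eventually_nhds_iff.1 (hχ.continuousAt.eventually_ne hne)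
  -- By continuity `χ` does not vanish on `(x₀, x₀ + ε)`. The one-sided interval keeps the radii
  -- nonnegative even when `x₀ = 0`.
  refine freeMeasure_annulus_ne_zero hs hs' hx₀ (lt_add_of_pos_right x₀ hε) ?_
  have hae : (fun u : HsRad s => if Integrable (fun x => V (u.toL2 x)) discMeasure then
        ENNReal.ofReal (χ ‖u.toL2‖ * Real.exp (-potential V u.toL2)) else 0) =ᵐ[freeMeasure s]
      fun u => ENNReal.ofReal (χ ‖u.toL2‖ * Real.exp (-potential V u.toL2)) := by
    filter_upwards [hint] with u hu
    rw [if_pos hu]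
  have hχm : Measurable fun u : HsRad s => χ ‖u.toL2‖ :=
    (hχ.comp (HsRad.continuous_toL2 hs).norm).measurable
  have hm : AEMeasurable (fun u : HsRad s =>
      ENNReal.ofReal (χ ‖u.toL2‖ * Real.exp (-potential V u.toL2))) (freeMeasure s) :=
    (hχm.aemeasurable.mul (Real.measurable_exp.comp_aemeasurable
      hmeas.aemeasurable.neg)).ennreal_ofReal
  rw [gibbsMeasure, withDensity_congr_ae (by convert hae), withDensity_eq_zero_iff hm] at h0
  have h1 : ∀ᵐ u ∂freeMeasure s, ¬ (x₀ < ‖u.toL2‖ ∧ ‖u.toL2‖ < x₀ + ε) := by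
    filter_upwards [h0] with u hu hmem
    have hd : dist ‖u.toL2‖ x₀ < ε := by
      rw [Real.dist_eq, abs_lt]
      constructor <;> linarith [hmem.1, hmem.2]
    have hpos : 0 < χ ‖u.toL2‖ := lt_of_le_of_ne (hχ0 _) (hball hd).symm
    have h2 : χ ‖u.toL2‖ * Real.exp (-potential V u.toL2) ≤ 0 := ENNReal.ofReal_eq_zero.1 hu
    have h3 := mul_pos hpos (Real.exp_pos (-potential V u.toL2))
    linarith
  simpa [ae_iff] using h1

end DiscNLS

end

/-! ### The theorem -/

theorem theorem1 (V : ℂ → ℝ) (α β s : ℝ)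
    (hV : ContDiff ℝ ∞ V) (hgauge : DiscNLS.GaugeInvariant V)
    (hα : 0 < α ∧ α < 4) (hgrowth : DiscNLS.GrowthBound V α)
    (hβ : 2 ≤ β ∧ β < 4) (hdefoc : DiscNLS.Defocusing V β)
    (hs : max (1 / 3) (max (1 - 2 / α) (1 - 2 / β)) < s) (hs' : s < 1 / 2) :
    -- the integral of `V(u)` over the disc is almost surely finite
    (∀ᵐ u ∂(DiscNLS.freeMeasure s),
      Integrable (fun x => V (u.toL2 x)) DiscNLS.discMeasure) ∧
    -- the integral of `V(u)` over the disc belongs to `L¹(dμ)`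
    Integrable (fun u : DiscNLS.HsRad s => DiscNLS.potential V u.toL2)
      (DiscNLS.freeMeasure s) ∧
    -- the integrals of `V(S_N u)` belong to `L¹(dμ)` and converge there to that of `V(u)`
    (∀ (N : ℕ) (u : DiscNLS.HsRad s),
      Integrable (fun x => V (DiscNLS.proj N u.toL2 x)) DiscNLS.discMeasure) ∧
    (∀ N : ℕ, Integrable
      (fun u : DiscNLS.HsRad s => DiscNLS.potential V (DiscNLS.proj N u.toL2))
      (DiscNLS.freeMeasure s)) ∧
    Tendsto
      (fun N : ℕ => eLpNorm
        (fun u : DiscNLS.HsRad s =>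
          DiscNLS.potential V (DiscNLS.proj N u.toL2) - DiscNLS.potential V u.toL2)
        1 (DiscNLS.freeMeasure s))
      atTop (𝓝 0) ∧
    -- the Gibbs measure is nontrivial
    (∀ χ : ℝ → ℝ, Continuous χ → HasCompactSupport χ → (∀ x, 0 ≤ χ x) →
      (∃ x, 0 ≤ x ∧ χ x ≠ 0) → DiscNLS.gibbsMeasure s V χ ≠ 0) := by
  have hs0 : 0 ≤ s := by
    have := (le_max_left (1 / 3 : ℝ) _).trans hs.le
    linarith
  have hVc : Continuous V := hV.continuous
  have hT := DiscNLS.HsRad.continuous_toL2 hs0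
  have := DiscNLS.isProbabilityMeasure_freeMeasure hs0 hs'
  obtain ⟨C₀, hC₀, h₀⟩ := hgrowth.exists_abs_le hα.2
  obtain ⟨C, hC, hdiff⟩ := hgrowth.exists_abs_sub_le hα.2 (hV.differentiable (by simp))
  have h6 := DiscNLS.lintegral_pow_six_lt_top hs0 hs'
  have hae := DiscNLS.ae_integrable_comp hT hVc hC₀ h₀ h6
  have hint := DiscNLS.integrable_potential hT hVc hC₀ h₀ h6
  refine ⟨hae, hint, fun N u => DiscNLS.integrable_comp_proj hVc N u.toL2, fun N => ?_,
    DiscNLS.tendsto_eLpNorm_potential_sub hs0 hs' hVc hC₀ h₀ hC hdiff, ?_⟩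
  · obtain ⟨B, hB⟩ := DiscNLS.exists_lintegral_proj_pow_six_le hs0 hs'
    exact DiscNLS.integrable_potential ((DiscNLS.continuous_proj N).comp hT) hVc hC₀ h₀
      ((hB N).trans_lt ENNReal.coe_lt_top)
  · intro χ hχ _ hχ0 hχne
    exact DiscNLS.gibbsMeasure_ne_zero hs0 hs' hae hint.aestronglyMeasurable hχ hχ0 hχne
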